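/- A matrix $A=(a_{ij})\in\mathbb C^{7\times 7}$ belongs to $\mathbf{RM}_7$ if it is tridiagonal ($a_{ij}=0$ for $|i-j|>1$), has zero main diagonal, and satisfies $a_{j,j+1}a_{j+1,j}=1$ for $j=1,\dots,6$. For such $A$ put $\xi_j=(|a_{j,j+1}|-|a_{j+1,j}|)^2/4$, $j=1,\dots,6$. The Kippenhahn curve $C(A)\subset\mathbb C$ is the envelope of the family of lines $e^{-i\theta}(\lambda_j(\theta)+i\mathbb R)$, $\theta\in\mathbb R$, $j=1,\dots,7$, where $\lambda_1(\theta),\dots,\lambda_7(\theta)$ are the (analytically chosen) eigenvalues of the Hermitian matrix $\frac12\left(e^{i\theta}A+e^{-i\theta}A^*\right)$. Ellipses are understood to be nondegenerate (positive minor half-axis). **Theorem.** Let $$\vec\xi_1=\left(1,\,0,\,-7\sqrt2+4\sqrt{10-7\sqrt2}+9,\ 2\left(\sqrt2-2\sqrt{2(\sqrt2+2)}+4\right),\ -8\sqrt2+6\sqrt{4-2\sqrt2}+5,\ 2\left(2\sqrt2+\sqrt{20-14\sqrt2}-3\right)\right)$$ $$\approx(1,0,0.368606,0.375923,0.180645,0.553537),$$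 $$\vec\xi_2=\left(1,\,0,\,-2\sqrt{\sqrt2+2}+\tfrac{3}{\sqrt2}+2,\ 2\sqrt{2-\sqrt2}+\tfrac1{\sqrt2}-2,\ 2\left(\sqrt2-2\sqrt{2(\sqrt2+2)}+4\right),\ -6\sqrt2+4\sqrt{7\sqrt2+10}-9\right)$$ $$\approx(1,0,0.425802,0.237841,0.375923,0.358259).$$ There are vectors $\vec\xi_3,\vec\xi_4\in\mathbb R^6$, with first entry exactly $1$ and third entry exactly $0$, $$\vec\xi_3\approx(1,1.69724,0,1.01396,1.19026,0.790003),\qquad \vec\xi_4\approx(1,1.51367,0,1.04120,0.944947,0.900544),$$ and numbers $c_3\approx1.64233$, $c_3^0\approx0.544959$, $c_4\approx1.58546$, $c_4^0\approx0.610752$ (every $\approx$ means equality up to half a unit of the last printed digit), such that the following holds. Put $$c_1=c_2=1,\qquad c_1^0=\sqrt{15-9\sqrt2-4\sqrt{20-14\sqrt2}},\qquad c_2^0=\sqrt{2\left(\sqrt{2(\sqrt2+2)}-\sqrt2-1\right)},$$ and for $i=1,\dots,4$ let $\vec\xi_{i+4}$ be the reversal of $\vec\xi_i$ (its $j$-th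 entry is the $(7-j)$-th entry of $\vec\xi_i$), $c_{i+4}=c_i$ and $c^0_{i+4}=c^0_i$. For every $A\in\mathbf{RM}_7$: 1. $C(A)$ contains an ellipse $E$ with foci $\sqrt{2+\sqrt2}$ and $-\sqrt2$ if and only if $(\xi_1,\dots,\xi_6)=t\,\vec\xi_j$ for some $t>0$ and some $j\in\{1,\dots,8\}$. Equivalently, $C(A)$ contains an ellipse with foci $\sqrt2$ and $-\sqrt{2+\sqrt2}$. 2. If $(\xi_1,\dots,\xi_6)=t\,\vec\xi_j$ with $t>0$, then $$C(A)=E\cup(-E)\cup E_0\cup\{0\},$$ where $E$ is an ellipse with foci $\sqrt{2+\sqrt2}$ and $-\sqrt2$ and minor half-axis $c_j\sqrt t$ (the only ellipse with these foci contained in $C(A)$), and $E_0$ is an ellipse with foci $\pm\sqrt{2-\sqrt2}$ and minor half-axis $c_j^0\sqrt t$. -/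

import Mathlib

open scoped Matrix Topology Pointwise

noncomputable section

namespace Kippenhahn

/-- Reciprocal matrices with zero main diagonal: `A` is tridiagonal, its diagonal vanishes and
`a_{k,k+1} a_{k+1,k} = 1` for all `k`. The size of `A` is `n + 1`. -/
structure IsReciprocal {n : ℕ} (A : Matrix (Fin (n + 1)) (Fin (n + 1)) ℂ) : Prop where
  tridiagonal : ∀ i j : Fin (n + 1), (i : ℕ) + 1 < j ∨ (j : ℕ) + 1 < i → A i j = 0
  diag_eq_zero : ∀ i, A i i = 0
  mul_eq_one : ∀ k : Fin n, A k.castSucc k.succ * A k.succ k.castSucc = 1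

/-- `ξ_k = (|a_{k,k+1}| - |a_{k+1,k}|)² / 4` (indices start at zero). -/
def xi {n : ℕ} (A : Matrix (Fin (n + 1)) (Fin (n + 1)) ℂ) (k : Fin n) : ℝ :=
  (‖A k.castSucc k.succ‖ - ‖A k.succ k.castSucc‖) ^ 2 / 4

/-- The Hermitian part `(M + M*) / 2`. -/
def rePart {n : ℕ} (M : Matrix (Fin n) (Fin n) ℂ) : Matrix (Fin n) (Fin n) ℂ :=
  (1 / 2 : ℂ) • (M + Mᴴ)

/-- The Kippenhahn polynomial `det (Re (e^{iθ} A) - l I)`. -/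
def kippenhahnPoly {n : ℕ} (A : Matrix (Fin n) (Fin n) ℂ) (l θ : ℝ) : ℂ :=
  (rePart (Complex.exp (θ * Complex.I) • A) - (l : ℂ) • (1 : Matrix (Fin n) (Fin n) ℂ)).det

/-- The Kippenhahn curve: the envelope of the lines
`e^{-iθ} (l(θ) + iℝ) = {z | Re (e^{iθ} z) = l(θ)}`, where `l` runs through the (locally) analytic
branches of the roots of `kippenhahnPoly A · θ`. (By Rellich's theorem all the roots are given by
real analytic branches.) The envelope of a family of lines `G(z, φ) = 0` consists of the points
`z` with `G(z, θ) = 0` and `∂G/∂φ (z, θ) = 0` for some `θ`; here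
`G(z, φ) = Re (e^{iφ} z) - l(φ)`. -/
def curve {n : ℕ} (A : Matrix (Fin n) (Fin n) ℂ) : Set ℂ :=
  {z | ∃ (θ : ℝ) (l : ℝ → ℝ), AnalyticAt ℝ l θ ∧
    (∀ᶠ φ in 𝓝 θ, kippenhahnPoly A (l φ) φ = 0) ∧
    (Complex.exp (θ * Complex.I) * z).re - l θ = 0 ∧
    HasDerivAt (fun φ : ℝ => (Complex.exp (φ * Complex.I) * z).re - l φ) 0 θ}

/-- The ellipse with foci `f` and `g` and minor half-axis of length `b` (used with `0 < b`): its
major half-axis has length `√(b² + (|f - g| / 2)²)`. -/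
def ellipse (f g : ℂ) (b : ℝ) : Set ℂ :=
  {z | dist z f + dist z g = 2 * √(b ^ 2 + (dist f g / 2) ^ 2)}

/-- The curve of `A` contains a (nondegenerate) ellipse with foci `f` and `g`. -/
def ContainsEllipse {n : ℕ} (A : Matrix (Fin n) (Fin n) ℂ) (f g : ℂ) : Prop :=
  ∃ b : ℝ, 0 < b ∧ ellipse f g b ⊆ curve A

def vec₁ : Fin 6 → ℝ :=
  ![1, 0, -7 * √2 + 4 * √(10 - 7 * √2) + 9, 2 * (√2 - 2 * √(2 * (√2 + 2)) + 4),
    -8 * √2 + 6 * √(4 - 2 * √2) + 5, 2 * (2 * √2 + √(20 - 14 * √2) - 3)]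

def vec₂ : Fin 6 → ℝ :=
  ![1, 0, -2 * √(√2 + 2) + 3 / √2 + 2, 2 * √(2 - √2) + 1 / √2 - 2,
    2 * (√2 - 2 * √(2 * (√2 + 2)) + 4), -6 * √2 + 4 * √(7 * √2 + 10) - 9]

/-- `x` rounds to the number `y`, which is given with `d` decimals. -/
def Approx (x y : ℝ) (d : ℕ) : Prop := |x - y| ≤ 1 / 2 / 10 ^ d

end Kippenhahn

end

noncomputable section

namespace Kippenhahn

/-- The cubic `q` such that `l * q (l ^ 2)` is the characteristic polynomial of a Hermitian
tridiagonal `7 × 7` matrix with zero diagonal whose off-diagonal entries have squared absolute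
values `W`. -/
def cubic (W : Fin 6 → ℝ) (u : ℝ) : ℝ :=
  u ^ 3 - (W 0 + W 1 + W 2 + W 3 + W 4 + W 5) * u ^ 2 +
    (W 0 * W 2 + W 0 * W 3 + W 0 * W 4 + W 0 * W 5 + W 1 * W 3 + W 1 * W 4 + W 1 * W 5 +
      W 2 * W 4 + W 2 * W 5 + W 3 * W 5) * u -
    (W 0 * W 2 * W 4 + W 0 * W 2 * W 5 + W 0 * W 3 * W 5 + W 1 * W 3 * W 5)

lemma det_tridiagonal (b c : Fin 6 → ℂ) (l : ℂ) :
    (!![-l, b 0, 0, 0, 0, 0, 0;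
        c 0, -l, b 1, 0, 0, 0, 0;
        0, c 1, -l, b 2, 0, 0, 0;
        0, 0, c 2, -l, b 3, 0, 0;
        0, 0, 0, c 3, -l, b 4, 0;
        0, 0, 0, 0, c 4, -l, b 5;
        0, 0, 0, 0, 0, c 5, -l] : Matrix (Fin 7) (Fin 7) ℂ).det =
      -(l * ((l ^ 2) ^ 3 - (b 0 * c 0 + b 1 * c 1 + b 2 * c 2 + b 3 * c 3 + b 4 * c 4 + b 5 * c 5)
          * (l ^ 2) ^ 2 +
        (b 0 * c 0 * (b 2 * c 2) + b 0 * c 0 * (b 3 * c 3) + b 0 * c 0 * (b 4 * c 4) +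
          b 0 * c 0 * (b 5 * c 5) + b 1 * c 1 * (b 3 * c 3) + b 1 * c 1 * (b 4 * c 4) +
          b 1 * c 1 * (b 5 * c 5) + b 2 * c 2 * (b 4 * c 4) + b 2 * c 2 * (b 5 * c 5) +
          b 3 * c 3 * (b 5 * c 5)) * l ^ 2 -
        (b 0 * c 0 * (b 2 * c 2) * (b 4 * c 4) + b 0 * c 0 * (b 2 * c 2) * (b 5 * c 5) +
          b 0 * c 0 * (b 3 * c 3) * (b 5 * c 5) + b 1 * c 1 * (b 3 * c 3) * (b 5 * c 5)))) := by
  simp [Matrix.det_succ_row_zero, Fin.sum_univ_succ, Fin.succAbove]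
  ring

lemma ofReal_cubic (W : Fin 6 → ℝ) (u : ℝ) : ((cubic W u : ℝ) : ℂ) =
    (u : ℂ) ^ 3 - ((W 0 : ℂ) + W 1 + W 2 + W 3 + W 4 + W 5) * (u : ℂ) ^ 2 +
    ((W 0 : ℂ) * W 2 + W 0 * W 3 + W 0 * W 4 + W 0 * W 5 + W 1 * W 3 + W 1 * W 4 + W 1 * W 5 +
      W 2 * W 4 + W 2 * W 5 + W 3 * W 5) * u -
    ((W 0 : ℂ) * W 2 * W 4 + W 0 * W 2 * W 5 + W 0 * W 3 * W 5 + W 1 * W 3 * W 5) := by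
  simp only [cubic]; push_cast; ring

lemma rePart_apply {n : ℕ} (M : Matrix (Fin n) (Fin n) ℂ) (i j : Fin n) :
    rePart M i j = (M i j + starRingEnd ℂ (M j i)) / 2 := by
  simp [rePart, Matrix.add_apply, Matrix.conjTranspose_apply]; ring

lemma offDiag_mul_offDiag {a b : ℂ} (hab : a * b = 1) (θ : ℝ) :
    ((Complex.exp (θ * Complex.I) * a + starRingEnd ℂ (Complex.exp (θ * Complex.I) * b)) / 2) *
      ((Complex.exp (θ * Complex.I) * b + starRingEnd ℂ (Complex.exp (θ * Complex.I) * a)) / 2) =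
    (((‖a‖ - ‖b‖) ^ 2 / 4 + Real.cos θ ^ 2 : ℝ) : ℂ) := by
  set e := Complex.exp (θ * Complex.I) with he
  have hn : ‖a‖ * ‖b‖ = 1 := by rw [← norm_mul, hab, norm_one]
  have h1 : e * starRingEnd ℂ e = 1 := by
    rw [Complex.mul_conj, Complex.normSq_eq_norm_sq, he, Complex.norm_exp_ofReal_mul_I]; simp
  have ha : a * starRingEnd ℂ a = ((‖a‖ ^ 2 : ℝ) : ℂ) := by
    rw [Complex.mul_conj, Complex.normSq_eq_norm_sq]
  have hb : b * starRingEnd ℂ b = ((‖b‖ ^ 2 : ℝ) : ℂ) := by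
    rw [Complex.mul_conj, Complex.normSq_eq_norm_sq]
  have hab' : starRingEnd ℂ a * starRingEnd ℂ b = 1 := by rw [← map_mul, hab, map_one]
  have hc : e + starRingEnd ℂ e = 2 * Complex.cos θ := by
    rw [he, ← Complex.exp_conj, map_mul, Complex.conj_ofReal, Complex.conj_I, Complex.cos]
    ring_nf
  have hW : (((‖a‖ - ‖b‖) ^ 2 / 4 + Real.cos θ ^ 2 : ℝ) : ℂ) =
      (((‖a‖ ^ 2 : ℝ) : ℂ) + ((‖b‖ ^ 2 : ℝ) : ℂ) - 2) / 4 + ((e + starRingEnd ℂ e) / 2) ^ 2 := by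
    rw [hc]
    have : (‖a‖ - ‖b‖) ^ 2 = ‖a‖ ^ 2 + ‖b‖ ^ 2 - 2 := by nlinarith
    rw [this]; push_cast; ring
  rw [hW, ← ha, ← hb, map_mul, map_mul]
  linear_combination (e ^ 2 / 4) * hab + (starRingEnd ℂ e ^ 2 / 4) * hab' +
    (a * starRingEnd ℂ a + b * starRingEnd ℂ b - 2) / 4 * h1

lemma kippenhahnPoly_eq {A : Matrix (Fin 7) (Fin 7) ℂ} (hA : IsReciprocal A) (l θ : ℝ) :
    kippenhahnPoly A l θ =
      ((-(l * cubic (fun k => xi A k + Real.cos θ ^ 2) (l ^ 2)) : ℝ) : ℂ) := by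
  set H := rePart (Complex.exp (θ * Complex.I) • A) with hH
  have hmul (k : Fin 6) : H k.castSucc k.succ * H k.succ k.castSucc =
      ((xi A k + Real.cos θ ^ 2 : ℝ) : ℂ) := by
    rw [hH, rePart_apply, rePart_apply]
    exact offDiag_mul_offDiag (hA.mul_eq_one k) θ
  have hd (i : Fin 7) : H i i = 0 := by simp [hH, rePart_apply, hA.diag_eq_zero]
  have h0 (i j : Fin 7) (h : (i : ℕ) + 1 < j ∨ (j : ℕ) + 1 < i) : H i j = 0 := by
    simp [hH, rePart_apply, hA.tridiagonal i j h, hA.tridiagonal j i h.symm]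
  have hmat : H - (l : ℂ) • (1 : Matrix (Fin 7) (Fin 7) ℂ) =
      !![-(l : ℂ), H 0 1, 0, 0, 0, 0, 0;
        H 1 0, -l, H 1 2, 0, 0, 0, 0;
        0, H 2 1, -l, H 2 3, 0, 0, 0;
        0, 0, H 3 2, -l, H 3 4, 0, 0;
        0, 0, 0, H 4 3, -l, H 4 5, 0;
        0, 0, 0, 0, H 5 4, -l, H 5 6;
        0, 0, 0, 0, 0, H 6 5, -l] := by
    ext i j
    fin_cases i <;> fin_cases j <;>
      simp [Matrix.sub_apply, Matrix.smul_apply, hd, h0]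
  have hdet := det_tridiagonal (fun k => H k.castSucc k.succ) (fun k => H k.succ k.castSucc) l
  simp only [hmul] at hdet
  rw [kippenhahnPoly, ← hH, hmat]
  refine hdet.trans ?_
  push_cast [ofReal_cubic]
  ring

lemma exp_mul_re (θ : ℝ) (z : ℂ) :
    (Complex.exp (θ * Complex.I) * z).re = z.re * Real.cos θ - z.im * Real.sin θ := by
  rw [Complex.exp_mul_I, ← Complex.ofReal_cos, ← Complex.ofReal_sin]
  simp [Complex.cos_ofReal_re, Complex.sin_ofReal_re, mul_comm]

/-- `z` is the point of contact, at the parameter `θ`, of the line family with support function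
`l`. -/
def IsContact (z : ℂ) (l : ℝ → ℝ) (θ : ℝ) : Prop :=
  AnalyticAt ℝ l θ ∧ z.re * Real.cos θ - z.im * Real.sin θ = l θ ∧
    -z.re * Real.sin θ - z.im * Real.cos θ = deriv l θ

lemma isContact_iff {z : ℂ} {l : ℝ → ℝ} {θ : ℝ} : IsContact z l θ ↔ AnalyticAt ℝ l θ ∧
    (Complex.exp (θ * Complex.I) * z).re - l θ = 0 ∧
    HasDerivAt (fun φ : ℝ => (Complex.exp (φ * Complex.I) * z).re - l φ) 0 θ := by
  simp only [exp_mul_re]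
  refine and_congr_right fun hl => and_congr sub_eq_zero.symm ?_
  have h : HasDerivAt (fun φ : ℝ => z.re * Real.cos φ - z.im * Real.sin φ - l φ)
      (-z.re * Real.sin θ - z.im * Real.cos θ - deriv l θ) θ := by
    have := (((Real.hasDerivAt_cos θ).const_mul z.re).sub
      ((Real.hasDerivAt_sin θ).const_mul z.im)).sub hl.differentiableAt.hasDerivAt
    exact this.congr_deriv (by ring)
  constructor
  · intro h1; rw [h1, sub_self] at h; exact h
  · intro h1; exact sub_eq_zero.1 (h.unique h1)

lemma mem_curve_iff {A : Matrix (Fin 7) (Fin 7) ℂ} (hA : IsReciprocal A) {z : ℂ} :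
    z ∈ curve A ↔ ∃ (θ : ℝ) (l : ℝ → ℝ), IsContact z l θ ∧
      ∀ᶠ φ in 𝓝 θ, l φ * cubic (fun k => xi A k + Real.cos φ ^ 2) (l φ ^ 2) = 0 := by
  simp only [isContact_iff, curve, Set.mem_ofPred_eq, kippenhahnPoly_eq hA, Complex.ofReal_eq_zero,
    neg_eq_zero]
  refine exists_congr fun θ => exists_congr fun l => ?_
  tauto

lemma dist_ofReal (z : ℂ) (f : ℝ) : dist z f = √((z.re - f) ^ 2 + z.im ^ 2) := by
  rw [Complex.dist_eq_re_im]; simp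

lemma mem_ellipse_iff {p c b : ℝ} (hb : 0 < b) {z : ℂ} :
    z ∈ ellipse ((p + c : ℝ) : ℂ) ((p - c : ℝ) : ℂ) b ↔
      b ^ 2 * (z.re - p) ^ 2 + (b ^ 2 + c ^ 2) * z.im ^ 2 = (b ^ 2 + c ^ 2) * b ^ 2 := by
  have hc : (dist ((p + c : ℝ) : ℂ) ((p - c : ℝ) : ℂ) / 2) ^ 2 = c ^ 2 := by
    rw [Complex.dist_of_im_eq (by simp), Real.dist_eq, div_pow, sq_abs]; simp; ring
  rw [ellipse, Set.mem_ofPred_eq, hc, dist_ofReal, dist_ofReal]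
  set X := z.re - p with hX
  set y := z.im
  have e1 : z.re - (p + c) = X - c := by rw [hX]; ring
  have e2 : z.re - (p - c) = X + c := by rw [hX]; ring
  rw [e1, e2]
  have hr1 := Real.sq_sqrt (add_nonneg (sq_nonneg (X - c)) (sq_nonneg y))
  have hr2 := Real.sq_sqrt (add_nonneg (sq_nonneg (X + c)) (sq_nonneg y))
  have hr1' := Real.sqrt_nonneg ((X - c) ^ 2 + y ^ 2)
  have hr2' := Real.sqrt_nonneg ((X + c) ^ 2 + y ^ 2)
  have hpos : 0 < b ^ 2 + c ^ 2 := by positivity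
  have ha := Real.sq_sqrt hpos.le
  have ha' := Real.sqrt_pos.2 hpos
  set r₁ := √((X - c) ^ 2 + y ^ 2)
  set r₂ := √((X + c) ^ 2 + y ^ 2)
  set a := √(b ^ 2 + c ^ 2)
  rw [← ha]
  constructor
  · intro h
    have h3 : r₂ * a = a ^ 2 + c * X := by
      have : (r₂ - r₁) * (r₁ + r₂) = 4 * c * X := by nlinarith
      rw [h] at this
      nlinarith
    have h4 : r₂ ^ 2 * a ^ 2 = (a ^ 2 + c * X) ^ 2 := by rw [← h3]; ring
    rw [hr2] at h4
    have hb2 : b ^ 2 = a ^ 2 - c ^ 2 := by linarith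
    rw [hb2]
    linear_combination h4
  · intro h
    have hXa : X ^ 2 ≤ a ^ 2 := by
      have : b ^ 2 * X ^ 2 ≤ b ^ 2 * a ^ 2 := by nlinarith [sq_nonneg (a * y)]
      exact le_of_mul_le_mul_left this (by positivity)
    have hca : c ^ 2 ≤ a ^ 2 := by nlinarith
    have habs : |c * X| ≤ a ^ 2 := by
      rw [abs_mul, sq]
      exact mul_le_mul (abs_le_of_sq_le_sq hca ha'.le) (abs_le_of_sq_le_sq hXa ha'.le)
        (abs_nonneg _) ha'.le
    obtain ⟨hl, hu⟩ := abs_le.1 habs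
    have hb2 : b ^ 2 = a ^ 2 - c ^ 2 := by linarith
    rw [hb2] at h
    have h3 : r₂ * a = a ^ 2 + c * X := by
      refine (sq_eq_sq₀ (by positivity) (by linarith)).1 ?_
      rw [mul_pow, hr2]; linear_combination h
    have h4 : r₁ * a = a ^ 2 - c * X := by
      refine (sq_eq_sq₀ (by positivity) (by linarith)).1 ?_
      rw [mul_pow, hr1]; linear_combination h
    have : a * (r₁ + r₂) = a * (2 * a) := by linear_combination h3 + h4
    exact mul_left_cancel₀ ha'.ne' this

lemma neg_ellipse (f g : ℂ) (b : ℝ) : -ellipse f g b = ellipse (-f) (-g) b := by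
  ext z
  have h (u : ℂ) : dist (-z) u = dist z (-u) := by rw [← dist_neg_neg, neg_neg]
  rw [Set.mem_neg, ellipse, ellipse, Set.mem_ofPred_eq, Set.mem_ofPred_eq, h, h, dist_neg_neg]

lemma ellipse_comm (f g : ℂ) (b : ℝ) : ellipse f g b = ellipse g f b := by
  ext z
  rw [ellipse, ellipse, Set.mem_ofPred_eq, Set.mem_ofPred_eq, add_comm, dist_comm f g]

/-- A point of contact of the lines with support function `p cos φ ± √(c² cos² φ + b²)` lies on
the ellipse. -/
lemma IsContact.mem_ellipse {p c b θ : ℝ} {l : ℝ → ℝ} {z : ℂ} (hb : 0 < b)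
    (hz : IsContact z l θ)
    (hl : ∀ᶠ φ in 𝓝 θ, (l φ - p * Real.cos φ) ^ 2 = c ^ 2 * Real.cos φ ^ 2 + b ^ 2) :
    z ∈ ellipse ((p + c : ℝ) : ℂ) ((p - c : ℝ) : ℂ) b := by
  obtain ⟨han, h1, h2⟩ := hz
  rw [mem_ellipse_iff hb]
  have hd1 := ((han.differentiableAt.hasDerivAt.sub
    ((Real.hasDerivAt_cos θ).const_mul p)).pow 2)
  have hd2 := (((Real.hasDerivAt_cos θ).pow 2).const_mul (c ^ 2)).add_const (b ^ 2)
  have hd := (hd1.congr_of_eventuallyEq (hl.mono fun φ h => h.symm)).unique hd2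
  have hl0 := hl.self_of_nhds
  simp only [Pi.sub_apply] at hd
  set L := l θ
  set L' := deriv l θ
  have hcs := Real.sin_sq_add_cos_sq θ
  set C := Real.cos θ
  set S := Real.sin θ
  set m := L - p * C with hm
  have hm2 : m ^ 2 = c ^ 2 * C ^ 2 + b ^ 2 := hl0
  have hm0 : m ≠ 0 := by
    intro h; rw [h] at hm2; nlinarith [sq_nonneg (c * C), pow_pos hb 2]
  have hk : m * (L' + p * S) = -(c ^ 2 * C * S) := by
    norm_num at hd
    linear_combination hd / 2
  set X := z.re - p with hX
  have hx : z.re = X + p := by rw [hX]; ring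
  rw [hx] at h1 h2
  set y := z.im
  have e1 : X * C - y * S = m := by rw [hm]; linear_combination h1
  have e2 : m * (X * S + y * C) = c ^ 2 * C * S := by linear_combination (-m) * h2 - hk
  have e3 : m * X = (b ^ 2 + c ^ 2) * C := by
    linear_combination m * C * e1 + S * e2 + C * hm2 + (c ^ 2 * C - m * X) * hcs
  have e4 : m * y = -(b ^ 2 * S) := by
    linear_combination -m * S * e1 + C * e2 - S * hm2 - m * y * hcs
  have : m ^ 2 * (b ^ 2 * X ^ 2 + (b ^ 2 + c ^ 2) * y ^ 2) =
      m ^ 2 * ((b ^ 2 + c ^ 2) * b ^ 2) := by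
    linear_combination b ^ 2 * (m * X + (b ^ 2 + c ^ 2) * C) * e3 +
      (b ^ 2 + c ^ 2) * (m * y - b ^ 2 * S) * e4 - (b ^ 2 + c ^ 2) * b ^ 2 * hm2 +
      (b ^ 2 + c ^ 2) * b ^ 4 * hcs
  exact mul_left_cancel₀ (pow_ne_zero 2 hm0) this

lemma exists_isContact_of_mem_ellipse {p c b : ℝ} {z : ℂ} (hb : 0 < b)
    (hz : z ∈ ellipse ((p + c : ℝ) : ℂ) ((p - c : ℝ) : ℂ) b) :
    ∃ (θ : ℝ) (l : ℝ → ℝ), IsContact z l θ ∧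
      ∀ φ, (l φ - p * Real.cos φ) ^ 2 = c ^ 2 * Real.cos φ ^ 2 + b ^ 2 := by
  rw [mem_ellipse_iff hb] at hz
  set X := z.re - p with hX
  have hx : z.re = X + p := by rw [hX]; ring
  set a2 := b ^ 2 + c ^ 2 with ha2
  have ha : 0 < a2 := by positivity
  set y := z.im
  have hb2 : 0 < b ^ 2 := by positivity
  set q := (X / a2) ^ 2 + (y / b ^ 2) ^ 2 with hq
  have hq0 : 0 < q := by
    rcases eq_or_ne X 0 with h | h
    · have : y ≠ 0 := by
        intro hy; rw [h, hy] at hz; nlinarith [mul_pos ha hb2]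
      positivity
    · positivity
  set ρ := 1 / √q with hρ
  have hρ0 : 0 < ρ := by positivity
  have hρq : ρ ^ 2 * q = 1 := by
    rw [hρ, div_pow, Real.sq_sqrt hq0.le]; field_simp
  obtain ⟨θ, hθc, hθs⟩ : ∃ θ : ℝ, Real.cos θ = X * ρ / a2 ∧ Real.sin θ = -(y * ρ / b ^ 2) := by
    have hn : ‖(⟨X * ρ / a2, -(y * ρ / b ^ 2)⟩ : ℂ)‖ = 1 := by
      rw [Complex.norm_def, Complex.normSq_mk, Real.sqrt_eq_one]
      rw [hq] at hρq
      linear_combination hρq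
    refine ⟨Complex.arg ⟨X * ρ / a2, -(y * ρ / b ^ 2)⟩, ?_, ?_⟩
    · rw [Complex.cos_arg (by rw [← norm_pos_iff, hn]; exact one_pos), hn, div_one]
    · rw [Complex.sin_arg, hn, div_one]
  have hpos (φ : ℝ) : 0 < c ^ 2 * Real.cos φ ^ 2 + b ^ 2 := by positivity
  have hρ2 : c ^ 2 * Real.cos θ ^ 2 + b ^ 2 = ρ ^ 2 := by
    have hcs := Real.sin_sq_add_cos_sq θ
    have h1 : X ^ 2 / a2 + y ^ 2 / b ^ 2 = 1 := by field_simp; linear_combination hz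
    have : c ^ 2 * Real.cos θ ^ 2 + b ^ 2 = a2 * Real.cos θ ^ 2 + b ^ 2 * Real.sin θ ^ 2 := by
      rw [ha2]; linear_combination (-b ^ 2) * hcs
    rw [this, hθc, hθs]
    have : a2 * (X * ρ / a2) ^ 2 + b ^ 2 * (-(y * ρ / b ^ 2)) ^ 2 =
        ρ ^ 2 * (X ^ 2 / a2 + y ^ 2 / b ^ 2) := by field_simp
    rw [this, h1, mul_one]
  have hXc : X * ρ = a2 * Real.cos θ := by rw [hθc]; field_simp
  have hyc : y * ρ = -(b ^ 2 * Real.sin θ) := by rw [hθs]; field_simp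
  have hder : HasDerivAt (fun φ => p * Real.cos φ + √(c ^ 2 * Real.cos φ ^ 2 + b ^ 2))
      (-(p * Real.sin θ) - c ^ 2 * Real.cos θ * Real.sin θ / ρ) θ := by
    have h1 := (((Real.hasDerivAt_cos θ).pow 2).const_mul (c ^ 2)).add_const (b ^ 2)
    have h2 := ((Real.hasDerivAt_cos θ).const_mul p).add (h1.sqrt (hpos θ).ne')
    refine h2.congr_deriv ?_
    simp only [Pi.pow_apply]
    rw [hρ2, Real.sqrt_sq hρ0.le]
    field_simp
    push_cast
    ring
  refine ⟨θ, fun φ => p * Real.cos φ + √(c ^ 2 * Real.cos φ ^ 2 + b ^ 2), ⟨?_, ?_, ?_⟩, ?_⟩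
  · have hcos : AnalyticAt ℝ Real.cos θ := Real.analyticAt_cos
    have h2 : AnalyticAt ℝ (fun φ => c ^ 2 * Real.cos φ ^ 2 + b ^ 2) θ :=
      (analyticAt_const.mul (hcos.pow 2)).add analyticAt_const
    have h3 : AnalyticAt ℝ (√·) (c ^ 2 * Real.cos θ ^ 2 + b ^ 2) :=
      (Real.contDiffAt_sqrt (hpos θ).ne').analyticAt
    exact (analyticAt_const.mul hcos).add (AnalyticAt.fun_comp (g := (√·))
      (f := fun φ => c ^ 2 * Real.cos φ ^ 2 + b ^ 2) h3 h2)
  · have hcs := Real.sin_sq_add_cos_sq θ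
    simp only
    rw [hρ2, Real.sqrt_sq hρ0.le, hx]
    refine mul_right_cancel₀ hρ0.ne' ?_
    linear_combination Real.cos θ * hXc - Real.sin θ * hyc + hρ2 + b ^ 2 * hcs +
      Real.cos θ ^ 2 * ha2
  · rw [hder.deriv, hx]
    refine mul_right_cancel₀ hρ0.ne' ?_
    have : c ^ 2 * Real.cos θ * Real.sin θ / ρ * ρ = c ^ 2 * Real.cos θ * Real.sin θ := by
      field_simp
    linear_combination (-Real.sin θ) * hXc - Real.cos θ * hyc + this -
      Real.cos θ * Real.sin θ * ha2
  · intro φ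
    rw [add_sub_cancel_left, Real.sq_sqrt (hpos φ).le]

lemma IsContact.mem_ellipse_foci {f g b θ : ℝ} {l : ℝ → ℝ} {z : ℂ} (hb : 0 < b)
    (hz : IsContact z l θ)
    (hl : ∀ᶠ φ in 𝓝 θ, (l φ - f * Real.cos φ) * (l φ - g * Real.cos φ) = b ^ 2) :
    z ∈ ellipse (f : ℂ) (g : ℂ) b := by
  have h := hz.mem_ellipse (p := (f + g) / 2) (c := (f - g) / 2) hb
    (hl.mono fun φ h => by linear_combination h)
  rwa [show (f + g) / 2 + (f - g) / 2 = f by ring, show (f + g) / 2 - (f - g) / 2 = g by ring] at h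

lemma exists_isContact_of_mem_ellipse_foci {f g b : ℝ} {z : ℂ} (hb : 0 < b)
    (hz : z ∈ ellipse (f : ℂ) (g : ℂ) b) :
    ∃ (θ : ℝ) (l : ℝ → ℝ), IsContact z l θ ∧
      ∀ φ, (l φ - f * Real.cos φ) * (l φ - g * Real.cos φ) = b ^ 2 := by
  obtain ⟨θ, l, h1, h2⟩ := exists_isContact_of_mem_ellipse (p := (f + g) / 2) (c := (f - g) / 2)
    (z := z) hb (by
      rwa [show (f + g) / 2 + (f - g) / 2 = f by ring, show (f + g) / 2 - (f - g) / 2 = g by ring])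
  exact ⟨θ, l, h1, fun φ => by linear_combination h2 φ⟩

lemma eventually_eq_zero_or_of_mul {f g : ℝ → ℝ} {x : ℝ} (hf : AnalyticAt ℝ f x)
    (hg : AnalyticAt ℝ g x) (h : ∀ᶠ y in 𝓝 x, f y * g y = 0) :
    (∀ᶠ y in 𝓝 x, f y = 0) ∨ ∀ᶠ y in 𝓝 x, g y = 0 := by
  refine hf.eventually_eq_zero_or_eventually_ne_zero.imp_right fun hne => ?_
  refine hg.frequently_zero_iff_eventually_zero.1 (Filter.Eventually.frequently ?_)
  filter_upwards [hne, h.filter_mono nhdsWithin_le_nhds] with y h1 h2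
  exact (mul_eq_zero.1 h2).resolve_left h1

/-- The quadratic in `u = l ^ 2` which, at `t = cos² θ`, is the equation of the branches belonging
to the ellipse with foci `f`, `g` and minor half-axis `b` and to its reflection in the origin. -/
def ellipseQuadratic (f g b t u : ℝ) : ℝ := (u + f * g * t - b ^ 2) ^ 2 - (f + g) ^ 2 * t * u

lemma ellipseQuadratic_sq (f g b C l : ℝ) : ellipseQuadratic f g b (C ^ 2) (l ^ 2) =
    ((l - f * C) * (l - g * C) - b ^ 2) * ((l - -f * C) * (l - -g * C) - b ^ 2) := by
  rw [ellipseQuadratic]; ring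

theorem curve_eq_of_factorization {A : Matrix (Fin 7) (Fin 7) ℂ} (hA : IsReciprocal A)
    {f g b h b₀ : ℝ} (hb : 0 < b) (hb₀ : 0 < b₀)
    (hfac : ∀ t u, cubic (fun k => xi A k + t) u =
      ellipseQuadratic f g b t u * (u - h ^ 2 * t - b₀ ^ 2)) :
    curve A = ellipse (f : ℂ) (g : ℂ) b ∪ -ellipse (f : ℂ) (g : ℂ) b ∪
      ellipse (h : ℂ) ((-h : ℝ) : ℂ) b₀ ∪ {0} := by
  have key (l : ℝ → ℝ) (φ : ℝ) :
      l φ * cubic (fun k => xi A k + Real.cos φ ^ 2) (l φ ^ 2) =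
      l φ * (((l φ - f * Real.cos φ) * (l φ - g * Real.cos φ) - b ^ 2) *
        (((l φ - -f * Real.cos φ) * (l φ - -g * Real.cos φ) - b ^ 2) *
          ((l φ - h * Real.cos φ) * (l φ - -h * Real.cos φ) - b₀ ^ 2))) := by
    rw [hfac, ellipseQuadratic_sq]; ring
  have hneg : -ellipse (f : ℂ) (g : ℂ) b = ellipse ((-f : ℝ) : ℂ) ((-g : ℝ) : ℂ) b := by
    rw [neg_ellipse]; push_cast; rfl
  rw [hneg]
  ext z
  rw [mem_curve_iff hA]
  simp only [key]
  constructor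
  · rintro ⟨θ, l, hz, hl⟩
    have hcos : AnalyticAt ℝ Real.cos θ := Real.analyticAt_cos
    have han (f g b : ℝ) :
        AnalyticAt ℝ (fun φ => (l φ - f * Real.cos φ) * (l φ - g * Real.cos φ) - b ^ 2) θ :=
      ((hz.1.sub (analyticAt_const.mul hcos)).mul
        (hz.1.sub (analyticAt_const.mul hcos))).sub analyticAt_const
    rcases eventually_eq_zero_or_of_mul hz.1
      ((han f g b).mul ((han (-f) (-g) b).mul (han h (-h) b₀))) hl with h0 | hl
    · right
      have hd : deriv l θ = 0 := by
        rw [Filter.EventuallyEq.deriv_eq (f := fun _ => (0 : ℝ)) h0]; simp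
      obtain ⟨-, h1, h2⟩ := hz
      rw [h0.self_of_nhds] at h1
      rw [hd] at h2
      have hcs := Real.sin_sq_add_cos_sq θ
      rw [Set.mem_singleton_iff]
      apply Complex.ext
      · rw [Complex.zero_re]
        linear_combination Real.cos θ * h1 - Real.sin θ * h2 - z.re * hcs
      · rw [Complex.zero_im]
        linear_combination (-Real.sin θ) * h1 - Real.cos θ * h2 - z.im * hcs
    left
    rcases eventually_eq_zero_or_of_mul (han f g b)
      ((han (-f) (-g) b).mul (han h (-h) b₀)) hl with h0 | hl
    · exact Or.inl (Or.inl (hz.mem_ellipse_foci hb (h0.mono fun φ h => sub_eq_zero.1 h)))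
    rcases eventually_eq_zero_or_of_mul (han (-f) (-g) b) (han h (-h) b₀) hl with h0 | h0
    · exact Or.inl (Or.inr (hz.mem_ellipse_foci hb (h0.mono fun φ h => sub_eq_zero.1 h)))
    · exact Or.inr (hz.mem_ellipse_foci hb₀ (h0.mono fun φ h => sub_eq_zero.1 h))
  · rintro (((hz | hz) | hz) | hz)
    · obtain ⟨θ, l, h1, h2⟩ := exists_isContact_of_mem_ellipse_foci hb hz
      exact ⟨θ, l, h1, Filter.Eventually.of_forall fun φ => by rw [h2]; ring⟩
    · obtain ⟨θ, l, h1, h2⟩ := exists_isContact_of_mem_ellipse_foci hb hz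
      exact ⟨θ, l, h1, Filter.Eventually.of_forall fun φ => by rw [h2]; ring⟩
    · obtain ⟨θ, l, h1, h2⟩ := exists_isContact_of_mem_ellipse_foci hb₀ hz
      exact ⟨θ, l, h1, Filter.Eventually.of_forall fun φ => by rw [h2]; ring⟩
    · refine ⟨0, fun _ => 0, ⟨analyticAt_const, ?_, ?_⟩, Filter.Eventually.of_forall fun φ => ?_⟩
      · rw [Set.mem_singleton_iff.1 hz]; simp
      · rw [Set.mem_singleton_iff.1 hz]; simp
      · simp

lemma neg_curve {A : Matrix (Fin 7) (Fin 7) ℂ} (hA : IsReciprocal A) : -curve A = curve A := by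
  have h (z : ℂ) (hz : z ∈ curve A) : -z ∈ curve A := by
    rw [mem_curve_iff hA] at hz ⊢
    obtain ⟨θ, l, ⟨h1, h2, h3⟩, hl⟩ := hz
    refine ⟨θ, fun φ => -l φ, ⟨h1.neg, ?_, ?_⟩, hl.mono fun φ h => ?_⟩
    · rw [Complex.neg_re, Complex.neg_im]; linear_combination -h2
    · rw [Complex.neg_re, Complex.neg_im, deriv.fun_neg]; linear_combination -h3
    · rw [neg_sq]; linear_combination -h
  ext z
  exact ⟨fun hz => by simpa using h _ hz, fun hz => h z hz⟩

lemma containsEllipse_neg_iff {A : Matrix (Fin 7) (Fin 7) ℂ} (hA : IsReciprocal A) (f g : ℂ) :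
    ContainsEllipse A f g ↔ ContainsEllipse A (-g) (-f) := by
  refine exists_congr fun b => and_congr_right fun _ => ?_
  rw [ellipse_comm (-g), ← neg_ellipse, ← Set.neg_subset_neg, neg_curve hA]

/-- The divided difference of the polynomial `l * cubic W (l ^ 2)`. -/
def cubicSlope (W : Fin 6 → ℝ) (a b : ℝ) : ℝ :=
  a ^ 6 + a ^ 5 * b + a ^ 4 * b ^ 2 + a ^ 3 * b ^ 3 + a ^ 2 * b ^ 4 + a * b ^ 5 + b ^ 6 -
    (W 0 + W 1 + W 2 + W 3 + W 4 + W 5) *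
      (a ^ 4 + a ^ 3 * b + a ^ 2 * b ^ 2 + a * b ^ 3 + b ^ 4) +
    (W 0 * W 2 + W 0 * W 3 + W 0 * W 4 + W 0 * W 5 + W 1 * W 3 + W 1 * W 4 + W 1 * W 5 +
      W 2 * W 4 + W 2 * W 5 + W 3 * W 5) * (a ^ 2 + a * b + b ^ 2) -
    (W 0 * W 2 * W 4 + W 0 * W 2 * W 5 + W 0 * W 3 * W 5 + W 1 * W 3 * W 5)

lemma sub_mul_cubicSlope (W : Fin 6 → ℝ) (a b : ℝ) :
    (a - b) * cubicSlope W a b = a * cubic W (a ^ 2) - b * cubic W (b ^ 2) := by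
  rw [cubicSlope, cubic, cubic]; ring

/-- The Christoffel–Darboux identity for the continuants of a tridiagonal matrix. -/
lemma exists_christoffel_darboux (W : Fin 6 → ℝ) (l : ℝ) : ∃ p₂ p₃ p₄ p₅ p₆ q₆ : ℝ,
    cubicSlope W l l * p₆ - l * cubic W (l ^ 2) * q₆ =
      p₆ ^ 2 + W 5 * (p₅ ^ 2 + W 4 * (p₄ ^ 2 + W 3 * (p₃ ^ 2 + W 2 * (p₂ ^ 2 +
        W 1 * (l ^ 2 + W 0))))) := by
  refine ⟨l ^ 2 - W 0, l * (l ^ 2 - W 0 - W 1),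
    l ^ 4 - (W 0 + W 1 + W 2) * l ^ 2 + W 0 * W 2,
    l * (l ^ 4 - (W 0 + W 1 + W 2 + W 3) * l ^ 2 + (W 0 * W 2 + W 0 * W 3 + W 1 * W 3)),
    l ^ 6 - (W 0 + W 1 + W 2 + W 3 + W 4) * l ^ 4 +
      (W 0 * W 2 + W 0 * W 3 + W 0 * W 4 + W 1 * W 3 + W 1 * W 4 + W 2 * W 4) * l ^ 2 -
      W 0 * W 2 * W 4,
    6 * l ^ 5 - 4 * (W 0 + W 1 + W 2 + W 3 + W 4) * l ^ 3 +
      2 * (W 0 * W 2 + W 0 * W 3 + W 0 * W 4 + W 1 * W 3 + W 1 * W 4 + W 2 * W 4) * l, ?_⟩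
  rw [cubicSlope, cubic]; ring

lemma cubicSlope_ne_zero {W : Fin 6 → ℝ} (hW : ∀ k, 0 < W k) {l : ℝ}
    (h : l * cubic W (l ^ 2) = 0) : cubicSlope W l l ≠ 0 := by
  obtain ⟨p₂, p₃, p₄, p₅, p₆, q₆, hcd⟩ := exists_christoffel_darboux W l
  intro h0
  rw [h, h0] at hcd
  have h0 := hW 0
  have h1 := hW 1
  have h2 := hW 2
  have h3 := hW 3
  have h4 := hW 4
  have h5 := hW 5
  have : 0 < p₆ ^ 2 + W 5 * (p₅ ^ 2 + W 4 * (p₄ ^ 2 + W 3 * (p₃ ^ 2 + W 2 * (p₂ ^ 2 +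
        W 1 * (l ^ 2 + W 0))))) := by positivity
  linarith

/-- Near a simple root, all branches agree. -/
lemma eventually_branch_eq {ξ : Fin 6 → ℝ} {θ₀ : ℝ} {z₀ : ℂ} {l₀ : ℝ → ℝ}
    (h₀ : IsContact z₀ l₀ θ₀)
    (hl₀ : ∀ᶠ φ in 𝓝 θ₀, l₀ φ * cubic (fun k => ξ k + Real.cos φ ^ 2) (l₀ φ ^ 2) = 0)
    (hs : cubicSlope (fun k => ξ k + Real.cos θ₀ ^ 2) (l₀ θ₀) (l₀ θ₀) ≠ 0) :
    ∀ᶠ p in 𝓝 (θ₀, z₀), ∀ l : ℝ → ℝ, IsContact p.2 l p.1 →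
      (∀ᶠ φ in 𝓝 p.1, l φ * cubic (fun k => ξ k + Real.cos φ ^ 2) (l φ ^ 2) = 0) →
      l =ᶠ[𝓝 p.1] l₀ := by
  have hcont : Continuous fun x : ℝ × ℝ × ℝ =>
      cubicSlope (fun k => ξ k + Real.cos x.2.2 ^ 2) x.1 x.2.1 := by
    unfold cubicSlope; fun_prop
  have hU : IsOpen {x : ℝ × ℝ × ℝ |
      cubicSlope (fun k => ξ k + Real.cos x.2.2 ^ 2) x.1 x.2.1 ≠ 0} :=
    isOpen_ne_fun hcont continuous_const
  have hfst : Filter.Tendsto (Prod.fst : ℝ × ℂ → ℝ) (𝓝 (θ₀, z₀)) (𝓝 θ₀) :=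
    continuous_fst.continuousAt
  have hre : Continuous fun p : ℝ × ℂ => p.2.re * Real.cos p.1 - p.2.im * Real.sin p.1 := by
    fun_prop
  have hmap : Filter.Tendsto (fun p : ℝ × ℂ =>
      (p.2.re * Real.cos p.1 - p.2.im * Real.sin p.1, l₀ p.1, p.1)) (𝓝 (θ₀, z₀))
      (𝓝 (l₀ θ₀, l₀ θ₀, θ₀)) := by
    have h1 := hre.tendsto (θ₀, z₀)
    rw [h₀.2.1] at h1
    exact h1.prodMk_nhds ((h₀.1.continuousAt.tendsto.comp hfst).prodMk_nhds hfst)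
  filter_upwards [hmap.eventually (hU.mem_nhds hs), hfst.eventually h₀.1.eventually_analyticAt,
    hfst.eventually hl₀.eventually_nhds] with p hp1 hp2 hp3 l hl hl'
  rw [hl.2.1] at hp1
  have hmap2 : Filter.Tendsto (fun φ => (l φ, l₀ φ, φ)) (𝓝 p.1) (𝓝 (l p.1, l₀ p.1, p.1)) :=
    hl.1.continuousAt.tendsto.prodMk_nhds (hp2.continuousAt.tendsto.prodMk_nhds Filter.tendsto_id)
  filter_upwards [hmap2.eventually (hU.mem_nhds hp1), hp3, hl'] with φ h1 h2 h3
  have := sub_mul_cubicSlope (fun k => ξ k + Real.cos φ ^ 2) (l φ) (l₀ φ)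
  rw [h2, h3, sub_zero] at this
  exact sub_eq_zero.1 ((mul_eq_zero.1 this).resolve_right h1)

/-- If the points of contact of a line family accumulate on an ellipse, the lines are tangent to
this ellipse. -/
lemma eventually_tangent {l : ℝ → ℝ} {θ₀ p c b : ℝ} (hb : 0 < b) (hl : AnalyticAt ℝ l θ₀)
    (h : ∃ᶠ φ in 𝓝[≠] θ₀,
      b ^ 2 * (l φ * Real.cos φ - deriv l φ * Real.sin φ - p) ^ 2 +
        (b ^ 2 + c ^ 2) * (-l φ * Real.sin φ - deriv l φ * Real.cos φ) ^ 2 =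
        (b ^ 2 + c ^ 2) * b ^ 2 ∧
      -l φ * Real.sin φ - deriv l φ * Real.cos φ ≠
        -l θ₀ * Real.sin θ₀ - deriv l θ₀ * Real.cos θ₀) :
    ∀ᶠ φ in 𝓝[≠] θ₀, (l φ - p * Real.cos φ) ^ 2 = c ^ 2 * Real.cos φ ^ 2 + b ^ 2 := by
  have hcos : AnalyticAt ℝ Real.cos θ₀ := Real.analyticAt_cos
  have hsin : AnalyticAt ℝ Real.sin θ₀ := Real.analyticAt_sin
  have hx' (φ : ℝ) (hφ : AnalyticAt ℝ l φ) :
      HasDerivAt (fun φ => l φ * Real.cos φ - deriv l φ * Real.sin φ - p)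
      (-(l φ + deriv (deriv l) φ) * Real.sin φ) φ := by
    have := ((hφ.differentiableAt.hasDerivAt.mul (Real.hasDerivAt_cos φ)).sub
      (hφ.deriv.differentiableAt.hasDerivAt.mul (Real.hasDerivAt_sin φ))).sub_const p
    exact this.congr_deriv (by ring)
  have hy' (φ : ℝ) (hφ : AnalyticAt ℝ l φ) :
      HasDerivAt (fun φ => -l φ * Real.sin φ - deriv l φ * Real.cos φ)
      (-(l φ + deriv (deriv l) φ) * Real.cos φ) φ := by
    have := (hφ.differentiableAt.hasDerivAt.neg.mul (Real.hasDerivAt_sin φ)).sub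
      (hφ.deriv.differentiableAt.hasDerivAt.mul (Real.hasDerivAt_cos φ))
    exact this.congr_deriv (by rw [Pi.neg_apply]; ring)
  set x : ℝ → ℝ := fun φ => l φ * Real.cos φ - deriv l φ * Real.sin φ - p with hx
  set y : ℝ → ℝ := fun φ => -l φ * Real.sin φ - deriv l φ * Real.cos φ with hy
  have hxan : AnalyticAt ℝ x θ₀ :=
    ((hl.mul hcos).sub (hl.deriv.mul hsin)).sub analyticAt_const
  have hyan : AnalyticAt ℝ y θ₀ := (hl.neg.mul hsin).sub (hl.deriv.mul hcos)
  have hGan : AnalyticAt ℝ (fun φ => b ^ 2 * x φ ^ 2 + (b ^ 2 + c ^ 2) * y φ ^ 2 -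
      (b ^ 2 + c ^ 2) * b ^ 2) θ₀ :=
    ((analyticAt_const.mul (hxan.pow 2)).add (analyticAt_const.mul (hyan.pow 2))).sub
      analyticAt_const
  have hG := hGan.frequently_zero_iff_eventually_zero.1
    (h.mono fun φ h => sub_eq_zero.2 h.1)
  rcases (hl.add hl.deriv.deriv).eventually_eq_zero_or_eventually_ne_zero with hv | hv
  · exfalso
    obtain ⟨ε, hε, hball⟩ := Metric.eventually_nhds_iff_ball.1 (hv.and hl.eventually_analyticAt)
    have hder (φ : ℝ) (hφ : φ ∈ Metric.ball θ₀ ε) : HasDerivAt y 0 φ := by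
      obtain ⟨h1, h2⟩ := hball φ hφ
      refine (hy' φ h2).congr_deriv ?_
      rw [Pi.add_apply] at h1
      rw [h1]; ring
    refine h ?_
    filter_upwards [mem_nhdsWithin_of_mem_nhds (Metric.ball_mem_nhds θ₀ hε)] with φ hφ hcon
    refine hcon.2 ?_
    exact Metric.isOpen_ball.is_const_of_deriv_eq_zero (convex_ball θ₀ ε).isPreconnected
      (fun ψ hψ => (hder ψ hψ).differentiableAt.differentiableWithinAt)
      (fun ψ hψ => (hder ψ hψ).deriv) hφ (Metric.mem_ball_self hε)
  · filter_upwards [hv, hG.eventually_nhds.filter_mono nhdsWithin_le_nhds,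
      hl.eventually_analyticAt.filter_mono nhdsWithin_le_nhds] with φ h1 h2 h3
    have hd := ((((hx' φ h3).pow 2).const_mul (b ^ 2)).add
      (((hy' φ h3).pow 2).const_mul (b ^ 2 + c ^ 2))).sub_const ((b ^ 2 + c ^ 2) * b ^ 2)
    have hd0 : HasDerivAt (fun _ : ℝ => (0 : ℝ)) _ φ :=
      hd.congr_of_eventuallyEq (h2.mono fun ψ h => h.symm)
    have hd1 := (hasDerivAt_const φ (0 : ℝ)).unique hd0
    have h20 := h2.self_of_nhds
    have hm : l φ - p * Real.cos φ = x φ * Real.cos φ - y φ * Real.sin φ := by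
      simp only [hx, hy]
      linear_combination (-l φ) * Real.sin_sq_add_cos_sq φ
    rw [hm]
    rw [Pi.add_apply] at h1
    have hcs := Real.sin_sq_add_cos_sq φ
    set C := Real.cos φ
    set S := Real.sin φ
    set X := x φ
    set Y := y φ
    have ht : b ^ 2 * X * S + (b ^ 2 + c ^ 2) * Y * C = 0 := by
      refine (mul_eq_zero.1 (?_ : (l φ + deriv (deriv l) φ) * _ = 0)).resolve_left h1
      norm_num at hd1
      linear_combination hd1 / 2
    set ρ2 := c ^ 2 * C ^ 2 + b ^ 2 with hρ2
    have hρ : 0 < ρ2 := by positivity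
    have e1 : (X * C - Y * S) * ((b ^ 2 + c ^ 2) * C) = X * ρ2 := by
      linear_combination (-S) * ht + b ^ 2 * X * hcs
    have e2 : (X * C - Y * S) * (b ^ 2 * S) = -(Y * ρ2) := by
      linear_combination C * ht - b ^ 2 * Y * hcs
    have e3 : (X * C - Y * S) ^ 2 * ((b ^ 2 * (b ^ 2 + c ^ 2)) * ρ2) =
        ρ2 * ((b ^ 2 * (b ^ 2 + c ^ 2)) * ρ2) := by
      linear_combination b ^ 2 * ((X * C - Y * S) * ((b ^ 2 + c ^ 2) * C) + X * ρ2) * e1 +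
        (b ^ 2 + c ^ 2) * ((X * C - Y * S) * (b ^ 2 * S) - Y * ρ2) * e2 + ρ2 ^ 2 * h20 -
        (X * C - Y * S) ^ 2 * b ^ 4 * (b ^ 2 + c ^ 2) * hcs
    exact mul_right_cancel₀ (by positivity) e3

lemma exists_accPt_of_not_countable {X : Type*} [TopologicalSpace X]
    [SecondCountableTopology X] {T : Set X} (hT : ¬T.Countable) :
    ∃ p ∈ T, AccPt p (Filter.principal T) := by
  by_contra! h
  have := discreteTopology_of_noAccPts h
  exact hT (Set.countable_coe_iff.1
    (TopologicalSpace.separableSpace_iff_countable.1 inferInstance))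

/-- The point of the ellipse with centre `p` and half-axes `√(b² + c²)`, `b` with imaginary part
`y` on the right half. -/
def ellipsePoint (p c b y : ℝ) : ℂ := ⟨p + √((b ^ 2 + c ^ 2) * (1 - y ^ 2 / b ^ 2)), y⟩

lemma ellipsePoint_mem {p c b y : ℝ} (hb : 0 < b) (hy : y ∈ Set.Ioo 0 b) :
    ellipsePoint p c b y ∈ ellipse ((p + c : ℝ) : ℂ) ((p - c : ℝ) : ℂ) b := by
  rw [mem_ellipse_iff hb, ellipsePoint]
  have h : y ^ 2 / b ^ 2 ≤ 1 := by
    rw [div_le_one (by positivity)]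
    exact pow_le_pow_left₀ hy.1.le hy.2.le 2
  rw [add_sub_cancel_left, Real.sq_sqrt (mul_nonneg (by positivity) (sub_nonneg.2 h))]
  field_simp
  ring

lemma not_countable_heights (ξ : Fin 6 → ℝ) {b : ℝ} (hb : 0 < b) :
    ¬(Set.Ioo 0 b \ {y | y * cubic ξ (y ^ 2) = 0}).Countable := by
  obtain ⟨e₁, e₂, e₃, he⟩ : ∃ e₁ e₂ e₃ : ℝ, ∀ u, cubic ξ u = u ^ 3 - e₁ * u ^ 2 + e₂ * u - e₃ :=
    ⟨_, _, _, fun u => rfl⟩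
  obtain ⟨P, hP⟩ : ∃ P : Polynomial ℝ, P = Polynomial.X ^ 7 -
      Polynomial.C e₁ * Polynomial.X ^ 5 + Polynomial.C e₂ * Polynomial.X ^ 3 -
      Polynomial.C e₃ * Polynomial.X := ⟨_, rfl⟩
  have hev (y : ℝ) : P.eval y = y * cubic ξ (y ^ 2) := by
    rw [hP, he]; simp; ring
  have hP0 : P ≠ 0 := by
    intro h
    have h7 : P.coeff 7 = 1 := by
      rw [hP]
      simp [Polynomial.coeff_X_pow]
    rw [h] at h7; simp at h7
  have hfin : {y : ℝ | y * cubic ξ (y ^ 2) = 0}.Finite := by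
    refine (Polynomial.finite_setOfPred_isRoot hP0).subset fun y hy => ?_
    exact (hev y).trans hy
  intro hc
  have h2 : (Set.Ioo 0 b).Countable :=
    (hc.union hfin.countable).mono fun y hy => by
      by_cases h : y * cubic ξ (y ^ 2) = 0
      · exact Or.inr h
      · exact Or.inl ⟨hy, h⟩
  have h3 := Cardinal.mk_Ioo_real hb
  rw [← Cardinal.le_aleph0_iff_set_countable, h3] at h2
  exact absurd h2 (not_le.2 Cardinal.aleph0_lt_continuum)

/-- If the curve contains an ellipse, then the branches of this ellipse are branches of the
Kippenhahn polynomial for the parameters in some interval. -/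
lemma exists_tangent_branch {A : Matrix (Fin 7) (Fin 7) ℂ} (hA : IsReciprocal A) {p c b : ℝ}
    (hb : 0 < b) (hsub : ellipse ((p + c : ℝ) : ℂ) ((p - c : ℝ) : ℂ) b ⊆ curve A) :
    ∃ (θ : ℝ) (l : ℝ → ℝ), ∀ᶠ φ in 𝓝[≠] θ,
      (l φ - p * Real.cos φ) ^ 2 = c ^ 2 * Real.cos φ ^ 2 + b ^ 2 ∧
      l φ * cubic (fun k => xi A k + Real.cos φ ^ 2) (l φ ^ 2) = 0 := by
  set Y := Set.Ioo 0 b \ {y | y * cubic (xi A) (y ^ 2) = 0} with hY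
  have hYc : ¬Y.Countable := not_countable_heights (xi A) hb
  have hex (y : ℝ) : ∃ (θ : ℝ) (l : ℝ → ℝ), y ∈ Y → IsContact (ellipsePoint p c b y) l θ ∧
      ∀ᶠ φ in 𝓝 θ, l φ * cubic (fun k => xi A k + Real.cos φ ^ 2) (l φ ^ 2) = 0 := by
    by_cases hy : y ∈ Y
    · obtain ⟨θ, l, h⟩ := (mem_curve_iff hA).1 (hsub (ellipsePoint_mem hb hy.1))
      exact ⟨θ, l, fun _ => h⟩
    · exact ⟨0, 0, fun h => absurd h hy⟩
  choose θ l hl using hex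
  set g : ℝ → ℝ × ℂ := fun y => (θ y, ellipsePoint p c b y) with hg
  have hinj : Set.InjOn g Y := fun y _ y' _ h => congrArg Complex.im (congrArg Prod.snd h)
  have hT : ¬(g '' Y).Countable := fun h => hYc (Set.countable_of_injective_of_countable_image hinj h)
  obtain ⟨-, ⟨y₀, hy₀, rfl⟩, hacc⟩ := exists_accPt_of_not_countable hT
  obtain ⟨hc₀, hb₀⟩ := hl y₀ hy₀
  refine ⟨θ y₀, l y₀, ?_⟩
  have hroot := hb₀.self_of_nhds
  have hcos : Real.cos (θ y₀) ≠ 0 := by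
    intro h
    have h1 := hc₀.2.1
    have hcs := Real.sin_sq_add_cos_sq (θ y₀)
    rw [h] at h1 hcs hroot
    have hsq : l y₀ (θ y₀) ^ 2 = y₀ ^ 2 := by
      rw [← h1, ellipsePoint]
      linear_combination y₀ ^ 2 * hcs
    have hne : y₀ * cubic (xi A) (y₀ ^ 2) ≠ 0 := hy₀.2
    simp only [ne_eq, OfNat.ofNat_ne_zero, not_false_eq_true, zero_pow, add_zero, hsq] at hroot
    refine hne ?_
    rcases mul_eq_zero.1 hroot with h2 | h2
    · rw [h2] at hsq
      rw [pow_eq_zero_iff (two_ne_zero) |>.1 (by rw [← hsq]; ring : y₀ ^ 2 = 0), zero_mul]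
    · rw [h2, mul_zero]
  have hW (k : Fin 6) : 0 < xi A k + Real.cos (θ y₀) ^ 2 :=
    add_pos_of_nonneg_of_pos (by rw [xi]; positivity) (by positivity)
  have hloc := eventually_branch_eq hc₀ hb₀ (cubicSlope_ne_zero hW hroot)
  have hfreq := ((accPt_iff_frequently.1 hacc).and_eventually hloc)
  have hfst : Filter.Tendsto (Prod.fst : ℝ × ℂ → ℝ) (𝓝 (g y₀)) (𝓝 (θ y₀)) :=
    continuous_fst.continuousAt
  have hfreq' : ∃ᶠ φ in 𝓝[≠] θ y₀,
      b ^ 2 * (l y₀ φ * Real.cos φ - deriv (l y₀) φ * Real.sin φ - p) ^ 2 +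
        (b ^ 2 + c ^ 2) * (-l y₀ φ * Real.sin φ - deriv (l y₀) φ * Real.cos φ) ^ 2 =
        (b ^ 2 + c ^ 2) * b ^ 2 ∧
      -l y₀ φ * Real.sin φ - deriv (l y₀) φ * Real.cos φ ≠
        -l y₀ (θ y₀) * Real.sin (θ y₀) - deriv (l y₀) (θ y₀) * Real.cos (θ y₀) := by
    rw [frequently_nhdsWithin_iff]
    refine hfst.frequently (hfreq.mono ?_)
    rintro _ ⟨⟨hne, y, hy, rfl⟩, hbr⟩
    obtain ⟨hc1, hb1⟩ := hl y hy
    have heq := hbr (l y) hc1 hb1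
    obtain ⟨-, h1, h2⟩ := hc1
    obtain ⟨-, h10, h20⟩ := hc₀
    simp only [hg] at heq ⊢
    rw [heq.deriv_eq] at h2
    rw [heq.self_of_nhds] at h1
    have hcs := Real.sin_sq_add_cos_sq (θ y)
    have hcs0 := Real.sin_sq_add_cos_sq (θ y₀)
    have hx : l y₀ (θ y) * Real.cos (θ y) - deriv (l y₀) (θ y) * Real.sin (θ y) =
        (ellipsePoint p c b y).re := by
      rw [← h1, ← h2]; linear_combination (ellipsePoint p c b y).re * hcs
    have hyy : -l y₀ (θ y) * Real.sin (θ y) - deriv (l y₀) (θ y) * Real.cos (θ y) =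
        (ellipsePoint p c b y).im := by
      rw [← h1, ← h2]; linear_combination (ellipsePoint p c b y).im * hcs
    have hyy0 : -l y₀ (θ y₀) * Real.sin (θ y₀) - deriv (l y₀) (θ y₀) * Real.cos (θ y₀) =
        (ellipsePoint p c b y₀).im := by
      rw [← h10, ← h20]; linear_combination (ellipsePoint p c b y₀).im * hcs0
    have hne' : y ≠ y₀ := fun h => hne (by rw [h])
    rw [hx, hyy, hyy0]
    refine ⟨⟨(mem_ellipse_iff hb).1 (ellipsePoint_mem hb hy.1), hne'⟩, ?_⟩
    intro hθ
    rw [Set.mem_singleton_iff] at hθ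
    rw [hθ] at hyy
    exact hne' (hyy.symm.trans hyy0)
  filter_upwards [eventually_tangent hb hc₀.1 hfreq', hb₀.filter_mono nhdsWithin_le_nhds]
    with φ h1 h2
  exact ⟨h1, h2⟩

/-- A polynomial vanishes if it vanishes at the common parameters `t` of the Kippenhahn
polynomial and of an ellipse contained in the curve. -/
lemma polynomial_eq_zero_of_ellipse_subset {A : Matrix (Fin 7) (Fin 7) ℂ} (hA : IsReciprocal A)
    {f g b : ℝ} (hb : 0 < b) (hfg : f * g < 0)
    (hsub : ellipse (f : ℂ) (g : ℂ) b ⊆ curve A) (q : Polynomial ℝ)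
    (hq : ∀ t u, cubic (fun k => xi A k + t) u = 0 → ellipseQuadratic f g b t u = 0 →
      q.eval t = 0) : q = 0 := by
  obtain ⟨θ, l, hl⟩ := exists_tangent_branch (p := (f + g) / 2) (c := (f - g) / 2) hA hb (by
    rwa [show (f + g) / 2 + (f - g) / 2 = f by ring, show (f + g) / 2 - (f - g) / 2 = g by ring])
  have han (x : ℝ) : AnalyticAt ℝ (fun φ => q.eval (Real.cos φ ^ 2)) x := by
    have hcos : AnalyticAt ℝ (fun φ => Real.cos φ ^ 2) x := Real.analyticAt_cos.pow 2
    simpa [Polynomial.aeval_def] using hcos.aeval_polynomial q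
  have hev : ∀ᶠ φ in 𝓝[≠] θ, q.eval (Real.cos φ ^ 2) = 0 := by
    refine hl.mono fun φ ⟨h1, h2⟩ => ?_
    have h3 : (l φ - f * Real.cos φ) * (l φ - g * Real.cos φ) = b ^ 2 := by
      linear_combination h1
    have hl0 : l φ ≠ 0 := by
      intro h0
      rw [h0] at h3
      nlinarith [sq_nonneg (Real.cos φ), pow_pos hb 2]
    refine hq _ _ ((mul_eq_zero.1 h2).resolve_left hl0) ?_
    rw [ellipseQuadratic_sq, h3, sub_self, zero_mul]
  have hev' := (han θ).frequently_zero_iff_eventually_zero.1 hev.frequently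
  have hall : (fun φ => q.eval (Real.cos φ ^ 2)) = fun _ => 0 :=
    AnalyticOnNhd.eq_of_eventuallyEq (z₀ := θ) (fun x _ => han x)
      (fun x _ => analyticAt_const) hev'
  refine Polynomial.eq_zero_of_infinite_isRoot q
    ((Set.Icc_infinite (zero_lt_one' ℝ)).mono fun t ht => ?_)
  have h1 : √t ≤ 1 := Real.sqrt_le_one.2 ht.2
  have := congrFun hall (Real.arccos √t)
  beta_reduce at this
  rwa [Real.cos_arccos (by linarith [Real.sqrt_nonneg t]) h1, Real.sq_sqrt ht.1] at this

/-- Division of the Kippenhahn cubic by the quadratic of an ellipse whose foci are asymptotically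
correct. -/
lemma exists_cubic_remainder (ξ : Fin 6 → ℝ) {f g h b : ℝ} (h₁ : f ^ 2 + g ^ 2 + h ^ 2 = 6)
    (h₂ : f ^ 2 * g ^ 2 + (f ^ 2 + g ^ 2) * h ^ 2 = 10) (h₃ : f ^ 2 * g ^ 2 * h ^ 2 = 4) :
    ∃ d m n α β γ : ℝ, ∀ t u, cubic (fun k => ξ k + t) u =
      ellipseQuadratic f g b t u * (u - h ^ 2 * t - d) +
        ((m * t + n) * u + (α * t ^ 2 + β * t + γ)) := by
  set d := ξ 0 + ξ 1 + ξ 2 + ξ 3 + ξ 4 + ξ 5 - 2 * b ^ 2 with hd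
  refine ⟨d, 4 * ξ 0 + 3 * ξ 1 + 3 * ξ 2 + 3 * ξ 3 + 3 * ξ 4 + 4 * ξ 5 -
      (-2 * f * g * b ^ 2 + 2 * b ^ 2 * h ^ 2 + d * (f ^ 2 + g ^ 2)),
    ξ 0 * ξ 2 + ξ 0 * ξ 3 + ξ 0 * ξ 4 + ξ 0 * ξ 5 + ξ 1 * ξ 3 + ξ 1 * ξ 4 + ξ 1 * ξ 5 +
      ξ 2 * ξ 4 + ξ 2 * ξ 5 + ξ 3 * ξ 5 - (b ^ 4 + 2 * b ^ 2 * d),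
    f ^ 2 * g ^ 2 * d - 2 * f * g * b ^ 2 * h ^ 2 -
      (3 * ξ 0 + ξ 1 + 2 * ξ 2 + 2 * ξ 3 + ξ 4 + 3 * ξ 5),
    b ^ 4 * h ^ 2 - 2 * f * g * b ^ 2 * d -
      (ξ 0 * ξ 2 + ξ 0 * ξ 4 + ξ 2 * ξ 4 + (ξ 0 * ξ 2 + ξ 0 * ξ 5 + ξ 2 * ξ 5) +
        (ξ 0 * ξ 3 + ξ 0 * ξ 5 + ξ 3 * ξ 5) + (ξ 1 * ξ 3 + ξ 1 * ξ 5 + ξ 3 * ξ 5)),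
    b ^ 4 * d - (ξ 0 * ξ 2 * ξ 4 + ξ 0 * ξ 2 * ξ 5 + ξ 0 * ξ 3 * ξ 5 + ξ 1 * ξ 3 * ξ 5),
    fun t u => ?_⟩
  rw [cubic, ellipseQuadratic]
  linear_combination t * u ^ 2 * h₁ - t ^ 2 * u * h₂ + t ^ 3 * h₃ - u ^ 2 * hd

theorem exists_factorization_of_ellipse_subset {A : Matrix (Fin 7) (Fin 7) ℂ}
    (hA : IsReciprocal A) {f g h b : ℝ} (h₁ : f ^ 2 + g ^ 2 + h ^ 2 = 6)
    (h₂ : f ^ 2 * g ^ 2 + (f ^ 2 + g ^ 2) * h ^ 2 = 10) (h₃ : f ^ 2 * g ^ 2 * h ^ 2 = 4)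
    (hb : 0 < b) (hfg : f * g < 0) (hfg' : f + g ≠ 0)
    (hsub : ellipse (f : ℂ) (g : ℂ) b ⊆ curve A) :
    ∃ d : ℝ, ∀ t u, cubic (fun k => xi A k + t) u =
      ellipseQuadratic f g b t u * (u - h ^ 2 * t - d) := by
  obtain ⟨d, m, n, α, β, γ, hrem⟩ := exists_cubic_remainder (xi A) (b := b) h₁ h₂ h₃
  refine ⟨d, fun t u => ?_⟩
  -- the resultant of the remainder and the quadratic, as a polynomial in `t`
  have hres (t : ℝ) : (2 * (α * t ^ 2 + β * t + γ) -
      (2 * (f * g * t - b ^ 2) - (f + g) ^ 2 * t) * (m * t + n)) ^ 2 =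
      (m * t + n) ^ 2 * ((f + g) ^ 2 * ((f - g) ^ 2 * t + 4 * b ^ 2) * t) := by
    set M : Polynomial ℝ := Polynomial.C m * Polynomial.X + Polynomial.C n with hM
    set N : Polynomial ℝ := Polynomial.C α * Polynomial.X ^ 2 + Polynomial.C β * Polynomial.X +
      Polynomial.C γ with hN
    set D : Polynomial ℝ := Polynomial.C (f * g) * Polynomial.X - Polynomial.C (b ^ 2) with hD
    have h0 := polynomial_eq_zero_of_ellipse_subset hA hb hfg hsub
      (N ^ 2 - (2 * D - Polynomial.C ((f + g) ^ 2) * Polynomial.X) * N * M + D ^ 2 * M ^ 2) (by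
        intro s v hc hq
        have h4 := hrem s v
        rw [hc, hq, zero_mul, zero_add] at h4
        rw [ellipseQuadratic] at hq
        simp only [hM, hN, hD, Polynomial.eval_add, Polynomial.eval_sub, Polynomial.eval_mul,
          Polynomial.eval_pow, Polynomial.eval_C, Polynomial.eval_X, Polynomial.eval_ofNat]
        linear_combination (m * s + n) ^ 2 * hq +
          (-(α * s ^ 2 + β * s + γ) + (m * s + n) * v +
            (2 * (f * g * s - b ^ 2) - (f + g) ^ 2 * s) * (m * s + n)) * h4)
    have h5 := congrArg (Polynomial.eval t) h0
    simp only [hM, hN, hD, Polynomial.eval_add, Polynomial.eval_sub, Polynomial.eval_mul,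
      Polynomial.eval_pow, Polynomial.eval_C, Polynomial.eval_X, Polynomial.eval_ofNat,
      Polynomial.eval_zero] at h5
    linear_combination 4 * h5
  set ε := 4 * b ^ 2 / (f - g) ^ 2 with hε
  have hfg2 : 0 < (f - g) ^ 2 := by nlinarith [sq_nonneg (f + g)]
  have hε0 : 0 < ε := by positivity
  have hneg (t : ℝ) (ht : t < 0) (ht' : -ε < t) :
      m * t + n = 0 ∧ α * t ^ 2 + β * t + γ = 0 := by
    have h6 : 0 < (f - g) ^ 2 * t + 4 * b ^ 2 := by
      have : (f - g) ^ 2 * ε = 4 * b ^ 2 := by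
        rw [hε, mul_comm, div_mul_cancel₀ _ hfg2.ne']
      nlinarith
    have h7 : (f + g) ^ 2 * ((f - g) ^ 2 * t + 4 * b ^ 2) * t < 0 :=
      mul_neg_of_pos_of_neg (by positivity) ht
    have h8 := hres t
    have h9 : m * t + n = 0 := by
      by_contra hne
      have : 0 < (m * t + n) ^ 2 := by positivity
      nlinarith [sq_nonneg (2 * (α * t ^ 2 + β * t + γ) -
        (2 * (f * g * t - b ^ 2) - (f + g) ^ 2 * t) * (m * t + n))]
    refine ⟨h9, ?_⟩
    rw [h9] at h8
    have : (α * t ^ 2 + β * t + γ) ^ 2 = 0 := by linear_combination h8 / 4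
    exact pow_eq_zero_iff two_ne_zero |>.1 this
  obtain ⟨e1, e2⟩ := hneg (-ε / 2) (by linarith) (by linarith)
  obtain ⟨e3, e4⟩ := hneg (-ε / 3) (by linarith) (by linarith)
  obtain ⟨-, e5⟩ := hneg (-ε / 4) (by linarith) (by linarith)
  have hm : m = 0 :=
    (mul_eq_zero.1 (by linear_combination 6 * e3 - 6 * e1 : m * ε = 0)).resolve_right hε0.ne'
  have hn : n = 0 := by rw [hm] at e1; linarith
  have hα : α = 0 :=
    (mul_eq_zero.1 (by linear_combination 24 * e2 - 72 * e4 + 48 * e5 :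
      α * ε ^ 2 = 0)).resolve_right (by positivity)
  have hβ : β = 0 := by
    rw [hα] at e2 e4
    exact (mul_eq_zero.1 (by linear_combination 6 * e4 - 6 * e2 :
      β * ε = 0)).resolve_right hε0.ne'
  have hγ : γ = 0 := by rw [hα, hβ] at e2; linarith
  rw [hrem, hm, hn, hα, hβ, hγ]; ring

/-- The relations and bounds characterizing `s = √2`, `w = √(2 + √2)` and `k = s w`. -/
structure IsRadicals (s w k : ℝ) : Prop where
  ss : s * s = 2
  ww : w * w = 2 + s
  ws : w * s = k
  sk : s * k = 2 * w
  wk : w * k = 2 * s + 2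
  kk : k * k = 4 + 2 * s
  s_gt : 1.4142135623 < s
  s_lt : s < 1.4142135624
  w_gt : 1.8477590650 < w
  w_lt : w < 1.8477590651
  k_gt : 2.6131259297 < k
  k_lt : k < 2.6131259298

lemma isRadicals : IsRadicals √2 √(2 + √2) (√(2 + √2) * √2) := by
  have h1 : √2 * √2 = 2 := Real.mul_self_sqrt (by norm_num)
  have h2 : √(2 + √2) * √(2 + √2) = 2 + √2 := Real.mul_self_sqrt (by positivity)
  have h3 : 1.41421356237 < √2 := (Real.lt_sqrt (by norm_num)).2 (by norm_num)
  have h4 : √2 < 1.41421356238 := (Real.sqrt_lt' (by norm_num)).2 (by norm_num)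
  have h5 : 1.84775906502 < √(2 + √2) := (Real.lt_sqrt (by norm_num)).2 (by norm_num; linarith)
  have h6 : √(2 + √2) < 1.84775906503 := (Real.sqrt_lt' (by norm_num)).2 (by norm_num; linarith)
  exact
    { ss := h1
      ww := h2
      ws := rfl
      sk := by linear_combination √(2 + √2) * h1
      wk := by linear_combination √2 * h2 + h1
      kk := by linear_combination √2 ^ 2 * h2 + (2 + √2) * h1
      s_gt := by linarith
      s_lt := by linarith
      w_gt := by linarith
      w_lt := by linarith
      k_gt := by nlinarith
      k_lt := by nlinarith }

/-- The equations for the parameters `x` of a matrix whose curve contains an ellipse with foci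
`w`, `-s` whose minor half-axis has square `B`; the remaining ellipse has minor half-axis
`√d`. -/
structure EllipseSystem (s w k : ℝ) (x : Fin 6 → ℝ) (B d : ℝ) : Prop where
  sum : x 0 + x 1 + x 2 + x 3 + x 4 + x 5 = 2 * B + d
  ends : x 0 + x 5 = (2 * k - 2 - 2 * s) * B + (1 + s) * d
  linear : 3 * (x 0 + x 5) + (x 1 + x 4) + 2 * (x 2 + x 3) = (4 + 2 * s) * d + (4 * k - 4 * w) * B
  quadratic : x 0 * x 2 + x 0 * x 3 + x 0 * x 4 + x 0 * x 5 + x 1 * x 3 + x 1 * x 4 + x 1 * x 5 +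
    x 2 * x 4 + x 2 * x 5 + x 3 * x 5 = B ^ 2 + 2 * B * d
  quadratic' : x 0 * x 2 + x 0 * x 4 + x 2 * x 4 + (x 0 * x 2 + x 0 * x 5 + x 2 * x 5) +
    (x 0 * x 3 + x 0 * x 5 + x 3 * x 5) + (x 1 * x 3 + x 1 * x 5 + x 3 * x 5) =
    (2 - s) * B ^ 2 + 2 * k * B * d
  cubic : x 0 * x 2 * x 4 + x 0 * x 2 * x 5 + x 0 * x 3 * x 5 + x 1 * x 3 * x 5 = B ^ 2 * d

lemma EllipseSystem.smul {s w k : ℝ} {x : Fin 6 → ℝ} {B d : ℝ} (h : EllipseSystem s w k x B d)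
    (c : ℝ) : EllipseSystem s w k (c • x) (c * B) (c * d) := by
  obtain ⟨h1, h2, h3, h4, h5, h6⟩ := h
  constructor <;> simp only [Pi.smul_apply, smul_eq_mul]
  · linear_combination c * h1
  · linear_combination c * h2
  · linear_combination c * h3
  · linear_combination c ^ 2 * h4
  · linear_combination c ^ 2 * h5
  · linear_combination c ^ 3 * h6

lemma EllipseSystem.rev {s w k : ℝ} {x : Fin 6 → ℝ} {B d : ℝ} (h : EllipseSystem s w k x B d) :
    EllipseSystem s w k (fun i => x i.rev) B d := by
  obtain ⟨h1, h2, h3, h4, h5, h6⟩ := h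
  have e0 : (0 : Fin 6).rev = 5 := rfl
  have e1 : (1 : Fin 6).rev = 4 := rfl
  have e2 : (2 : Fin 6).rev = 3 := rfl
  have e3 : (3 : Fin 6).rev = 2 := rfl
  have e4 : (4 : Fin 6).rev = 1 := rfl
  have e5 : (5 : Fin 6).rev = 0 := rfl
  constructor <;> simp only [e0, e1, e2, e3, e4, e5]
  · linear_combination h1
  · linear_combination h2
  · linear_combination h3
  · linear_combination h4
  · linear_combination h5
  · linear_combination h6

lemma factorization_iff {s w k : ℝ} (h : IsRadicals s w k) {x : Fin 6 → ℝ} {b d : ℝ} :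
    (∀ t u, cubic (fun i => x i + t) u =
      ellipseQuadratic w (-s) b t u * (u - (k - w) ^ 2 * t - d)) ↔
    EllipseSystem s w k x (b ^ 2) d := by
  have key (t u : ℝ) : cubic (fun i => x i + t) u -
      ellipseQuadratic w (-s) b t u * (u - (k - w) ^ 2 * t - d) =
      -(x 0 + x 1 + x 2 + x 3 + x 4 + x 5 - (2 * b ^ 2 + d)) * u ^ 2 +
      (3 * (x 0 + x 1 + x 2 + x 3 + x 4 + x 5 - (2 * b ^ 2 + d)) +
        (x 0 + x 5 - ((2 * k - 2 - 2 * s) * b ^ 2 + (1 + s) * d))) * (t * u) +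
      (x 0 * x 2 + x 0 * x 3 + x 0 * x 4 + x 0 * x 5 + x 1 * x 3 + x 1 * x 4 + x 1 * x 5 +
        x 2 * x 4 + x 2 * x 5 + x 3 * x 5 - ((b ^ 2) ^ 2 + 2 * b ^ 2 * d)) * u -
      (3 * (x 0 + x 5) + (x 1 + x 4) + 2 * (x 2 + x 3) -
        ((4 + 2 * s) * d + (4 * k - 4 * w) * b ^ 2)) * t ^ 2 -
      (x 0 * x 2 + x 0 * x 4 + x 2 * x 4 + (x 0 * x 2 + x 0 * x 5 + x 2 * x 5) +
        (x 0 * x 3 + x 0 * x 5 + x 3 * x 5) + (x 1 * x 3 + x 1 * x 5 + x 3 * x 5) -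
        ((2 - s) * (b ^ 2) ^ 2 + 2 * k * b ^ 2 * d)) * t -
      (x 0 * x 2 * x 4 + x 0 * x 2 * x 5 + x 0 * x 3 * x 5 + x 1 * x 3 * x 5 -
        (b ^ 2) ^ 2 * d) := by
    have hq : ellipseQuadratic w (-s) b t u =
        u ^ 2 - ((4 + s) * t + 2 * b ^ 2) * u + (k * t + b ^ 2) ^ 2 := by
      rw [ellipseQuadratic, mul_neg, h.ws]
      linear_combination (-t * u) * h.ww - t * u * h.ss + 2 * u * t * h.ws
    have hkw : (k - w) ^ 2 = 2 - s := by linear_combination h.kk + h.ww - 2 * h.wk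
    rw [hq, hkw, Kippenhahn.cubic]
    linear_combination (-t ^ 2 * u + (2 - s) * t ^ 3 + d * t ^ 2) * h.kk +
      (t ^ 2 * u - 2 * t ^ 3) * h.ss - 2 * t ^ 2 * b ^ 2 * h.sk
  constructor
  · intro hf
    have hz (t u : ℝ) := (key t u).symm.trans (sub_eq_zero.2 (hf t u))
    have h00 := hz 0 0
    have h01 := hz 0 1
    have h02 := hz 0 (-1)
    have h10 := hz 1 0
    have h20 := hz (-1) 0
    have h11 := hz 1 1
    norm_num at h00 h01 h02 h10 h20 h11
    constructor <;> linarith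
  · rintro ⟨h1, h2, h3, h4, h5, h6⟩ t u
    linear_combination key t u + (3 * t * u - u ^ 2) * h1 + t * u * h2 - t ^ 2 * h3 + u * h4 -
      t * h5 - h6

/-- The solutions of `EllipseSystem` for `B = 1`, up to reversal. -/
def solution (s w k : ℝ) : Fin 4 → Fin 6 → ℝ :=
  ![![1, 0, 9 - 7 * s + 12 * w - 8 * k, 8 + 2 * s - 4 * k, 5 - 8 * s + 12 * w - 6 * k,
      -6 + 4 * s - 8 * w + 6 * k],
    ![1, 0, 2 + 3 / 2 * s - 2 * w, -2 + 1 / 2 * s - 2 * w + 2 * k, 8 + 2 * s - 4 * k,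
      -9 - 6 * s + 4 * w + 4 * k],
    ![-1 + 5 / 2 * s - 4 * w + 2 * k, 2 - 5 / 2 * s + 4 * w - 2 * k, 0, 8 + 2 * s - 4 * k,
      -2 - 7 / 2 * s + 4 * w, 1 - 1 / 2 * s],
    ![-2 - 2 * s + 2 * k, 3 + 2 * s - 2 * k, 0, -1 + s, 8 + 2 * s - 4 * k,
      -9 - 6 * s + 4 * w + 4 * k]]

/-- The values of `d` belonging to `solution`. -/
def ratio (s w k : ℝ) : Fin 4 → ℝ :=
  ![15 - 9 * s + 16 * w - 12 * k, -2 - 2 * s + 2 * k, 6 - 2 * s + 4 * w - 4 * k, -3 - 3 * s + 4 * w]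

lemma ellipseSystem_solution {s w k : ℝ} (h : IsRadicals s w k) (j : Fin 4) :
    EllipseSystem s w k (solution s w k j) 1 (ratio s w k j) := by
  obtain ⟨h1, h2, h3, h4, h5, h6, -, -, -, -, -, -⟩ := h
  fin_cases j <;> constructor <;> simp [solution, ratio] <;> grind (splits := 0)

section Solutions

variable {s w k : ℝ} {x : Fin 6 → ℝ} {r : ℝ}

lemma eq_vec {a₀ a₁ a₂ a₃ a₄ a₅ : ℝ} (h₀ : x 0 = a₀) (h₁ : x 1 = a₁) (h₂ : x 2 = a₂)
    (h₃ : x 3 = a₃) (h₄ : x 4 = a₄) (h₅ : x 5 = a₅) : x = ![a₀, a₁, a₂, a₃, a₄, a₅] := by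
  ext i
  fin_cases i <;> assumption

lemma EllipseSystem.middle {d B : ℝ} (hx : EllipseSystem s w k x B d) :
    x 2 + x 3 = (2 + 4 * s - 4 * w) * B + d := by
  linear_combination hx.linear - hx.sum - 2 * hx.ends

lemma EllipseSystem.second (hx : EllipseSystem s w k x 1 r) :
    x 1 + x 4 = 2 - 2 * s + 4 * w - 2 * k - (1 + s) * r := by
  linear_combination hx.sum - hx.ends - hx.middle

lemma EllipseSystem.middle_ne_one (h : IsRadicals s w k) (hx : EllipseSystem s w k x 1 r)
    (hpos : ∀ i, 0 ≤ x i) : x 2 + x 3 ≠ 1 := by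
  intro h1
  have h2 := hx.middle
  rw [h1] at h2
  have h3 := hx.second
  have hr : r = -1 - 4 * s + 4 * w := by linear_combination -h2
  rw [hr] at h3
  have h4 : x 1 + x 4 = 11 + 3 * s - 6 * k := by
    linear_combination h3 + 4 * h.ss - 4 * h.ws
  linarith [hpos 1, hpos 4, h.s_lt, h.k_gt]

set_option maxHeartbeats 1000000 in
lemma EllipseSystem.eq_solution_of_second_eq_zero (h : IsRadicals s w k)
    (hx : EllipseSystem s w k x 1 r) (hpos : ∀ i, 0 ≤ x i) (h0 : x 1 = 0) :
    x = solution s w k 0 ∨ x = solution s w k 1 := by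
  have hz := hx.middle
  have hy := hx.second
  have hne := hx.middle_ne_one h hpos
  obtain ⟨e1, e2, -, e4, e5, e6⟩ := hx
  obtain ⟨r1, r2, r3, r4, r5, r6, b1, b2, b3, b4, b5, b6⟩ := h
  simp only [h0, zero_mul, zero_add, add_zero, mul_one, one_pow] at hz hy e1 e2 e4 e5 e6
  have hroot : (x 0 - 1) ^ 2 * (x 0 - r) = 0 := by
    linear_combination x 0 ^ 2 * e1 - x 0 * e4 + e6
  have h01 : x 0 = 1 := by
    rcases mul_eq_zero.1 hroot with h | h
    · exact sub_eq_zero.1 (pow_eq_zero_iff two_ne_zero |>.1 h)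
    · exfalso
      have hr : r = x 0 := by linarith
      rw [hr] at e1 e4
      have hs : x 2 + x 3 + x 4 + x 5 = 2 := by linarith
      have hq : x 2 * x 4 + x 2 * x 5 + x 3 * x 5 = 1 := by
        linear_combination e4 - x 0 * hs
      refine hne ?_
      have h1 : (x 2 + x 3 - 1) ^ 2 = -(x 3 * x 4) := by
        linear_combination (x 2 + x 3) * hs - hq
      have h2 := mul_nonneg (hpos 3) (hpos 4)
      have h3 : (x 2 + x 3 - 1) ^ 2 = 0 := le_antisymm (by linarith) (sq_nonneg _)
      exact sub_eq_zero.1 (pow_eq_zero_iff two_ne_zero |>.1 h3)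
  rw [h01] at e1 e2 e4 e5 e6
  have e7 : x 5 = 2 * k - 3 - 2 * s + (1 + s) * r := by linear_combination e2
  have e8 : x 3 = 2 + 4 * s - 4 * w + r - x 2 := by linear_combination hz
  have e9 : x 2 * x 4 + (x 2 + x 3) * x 5 = r := by linear_combination e6
  have e10 : 2 * x 2 + x 3 + x 4 + 2 * x 5 + r + x 3 * x 5 = 2 - s + 2 * k * r := by
    linear_combination e5 - e6
  have hy' := hy
  rw [e7, hy] at e9
  rw [show x 2 + x 3 = 2 + 4 * s - 4 * w + r by rw [hz]] at e9
  rw [e8, e7, hy] at e10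
  have hr0 : (-16 - 11 * s + 8 * w + 6 * k) *
      ((r - (15 - 9 * s + 16 * w - 12 * k)) * (r - (-2 - 2 * s + 2 * k))) = 0 := by
    clear hroot hne hz e1 e2 e4 e5 e6 e7 e8 hy b1 b2 b3 b4 b5 b6
    grind (splits := 0)
  have key (r₀ y₀ z₀ e₀ i₀ : ℝ) (hr : r = r₀) (hz : 2 + 4 * s - 4 * w + r₀ = z₀)
      (hy : 2 - 2 * s + 4 * w - 2 * k - (1 + s) * r₀ = y₀)
      (he : 2 * k - 3 - 2 * s + (1 + s) * r₀ = e₀) (hi : i₀ * y₀ = 1) :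
      x 2 = i₀ * (r₀ - z₀ * e₀) ∧ x 3 = z₀ - x 2 ∧ x 4 = y₀ ∧ x 5 = e₀ := by
    rw [hr, hy, he] at e9
    rw [hr] at e7 e8
    rw [hr, hy] at hy'
    refine ⟨?_, by rw [e8, hz], hy', by rw [e7, he]⟩
    linear_combination i₀ * e9 - x 2 * hi - i₀ * e₀ * hz
  rcases mul_eq_zero.1 ((mul_eq_zero.1 hr0).resolve_left (by intro h; linarith)) with hr | hr
  · left
    obtain ⟨f2, f3, f4, f5⟩ := key (15 - 9 * s + 16 * w - 12 * k) (5 - 8 * s + 12 * w - 6 * k)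
      (17 - 5 * s + 12 * w - 12 * k) (-6 + 4 * s - 8 * w + 6 * k)
      (83 / 47 + 32 / 47 * s + 12 / 47 * w + 42 / 47 * k) (sub_eq_zero.1 hr) (by ring)
      (by linear_combination 9 * r1 - 16 * r3 + 12 * r4)
      (by linear_combination -9 * r1 + 16 * r3 - 12 * r4)
      (by clear e9 e10 hr0 hr key; grind (splits := 0))
    have f2' : x 2 = 9 - 7 * s + 12 * w - 8 * k := by
      rw [f2]; clear e9 e10 hr0 hr f2 f3 f4 f5 key; grind (splits := 0)
    exact eq_vec h01 h0 f2' (by rw [f3, f2']; ring) f4 f5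
  · right
    obtain ⟨f2, f3, f4, f5⟩ := key (-2 - 2 * s + 2 * k) (8 + 2 * s - 4 * k)
      (2 * s - 4 * w + 2 * k) (-9 - 6 * s + 4 * w + 4 * k)
      (1 + 1 / 4 * s + 1 / 2 * k) (sub_eq_zero.1 hr) (by ring)
      (by linear_combination 2 * r1 - 2 * r4)
      (by linear_combination -2 * r1 + 2 * r4)
      (by clear e9 e10 hr0 hr key; grind (splits := 0))
    have f2' : x 2 = 2 + 3 / 2 * s - 2 * w := by
      rw [f2]; clear e9 e10 hr0 hr f2 f3 f4 f5 key; grind (splits := 0)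
    exact eq_vec h01 h0 f2' (by rw [f3, f2']; ring) f4 f5

set_option maxHeartbeats 1000000 in
lemma EllipseSystem.eq_solution_of_third_eq_zero (h : IsRadicals s w k)
    (hx : EllipseSystem s w k x 1 r) (hpos : ∀ i, 0 ≤ x i) (h0 : x 2 = 0) :
    x = solution s w k 2 ∨ x = solution s w k 3 := by
  have hz := hx.middle
  have hy := hx.second
  have hne := hx.middle_ne_one h hpos
  obtain ⟨e1, e2, -, e4, e5, e6⟩ := hx
  obtain ⟨r1, r2, r3, r4, r5, r6, b1, b2, b3, b4, b5, b6⟩ := h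
  simp only [h0, mul_zero, zero_mul, zero_add, add_zero, mul_one, one_pow] at hz hy hne e1 e2 e4 e5 e6
  have hroot : (x 0 + x 1 - 1) ^ 2 * (x 0 + x 1 - r) = 0 := by
    linear_combination (x 0 + x 1) ^ 2 * e1 - (x 0 + x 1) * e4 + e6
  have h01 : x 0 + x 1 = 1 := by
    rcases mul_eq_zero.1 hroot with h | h
    · exact sub_eq_zero.1 (pow_eq_zero_iff two_ne_zero |>.1 h)
    · exfalso
      have hr : r = x 0 + x 1 := by linarith
      have hs : x 3 + x 4 + x 5 = 2 := by linarith
      have hq : x 3 * x 5 = 1 := by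
        rw [hr] at e4
        linear_combination e4 - (x 0 + x 1) * hs
      refine hne ?_
      have h1 : (x 3 - 1) ^ 2 = -(x 3 * x 4) := by
        linear_combination x 3 * hs - hq
      have h2 := mul_nonneg (hpos 3) (hpos 4)
      have h3 : (x 3 - 1) ^ 2 = 0 := le_antisymm (by linarith) (sq_nonneg _)
      exact sub_eq_zero.1 (pow_eq_zero_iff two_ne_zero |>.1 h3)
  have e7 : x 3 * x 5 = r := by linear_combination e6 - x 3 * x 5 * h01
  have hr_nonneg : 0 ≤ r := by rw [← e7]; exact mul_nonneg (hpos 3) (hpos 5)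
  have e8 : x 4 + x 5 = 1 - (2 + 4 * s - 4 * w) := by linear_combination e1 - h01 - hz
  have e9 : x 0 = 2 * k - 2 - 2 * s + (1 + s) * r - x 5 := by linear_combination e2
  have e10 : x 0 * (x 4 + x 5) + x 5 + x 3 + 2 * r = 2 - s + 2 * k * r := by
    linear_combination e5 - (x 3 + x 5) * h01 - 2 * e7
  have hr0 : (-6 - 5 * s + 4 * w + 2 * k) *
      ((r - (6 - 2 * s + 4 * w - 4 * k)) * (r - (-3 - 3 * s + 4 * w))) = 0 := by
    rw [e8, e9] at e10
    have e11 : (2 * k - 2 - 2 * s + (1 + s) * r) * (2 + 4 * s - 4 * w + r) *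
        (1 - (2 + 4 * s - 4 * w)) - r * (1 - (2 + 4 * s - 4 * w)) + r +
        (2 + 4 * s - 4 * w + r) * (2 + 4 * s - 4 * w + r + 2 * r - 2 + s - 2 * k * r) = 0 := by
      rw [hz] at e7 e10
      linear_combination (2 + 4 * s - 4 * w + r) * e10 + (-(2 + 4 * s - 4 * w)) * e7
    clear hroot hne hz e1 e2 e4 e5 e6 e7 e8 e9 e10 hy b1 b2 b3 b4 b5 b6
    grind (splits := 0)
  have key (r₀ z₀ i₀ v₀ : ℝ) (hr : r = r₀) (hz₀ : 2 + 4 * s - 4 * w + r₀ = z₀)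
      (hi : i₀ * z₀ = 1) (hv : i₀ * r₀ = v₀) :
      x 3 = z₀ ∧ x 5 = v₀ ∧ x 4 = -1 - 4 * s + 4 * w - v₀ ∧
        x 0 = 2 * k - 2 - 2 * s + (1 + s) * r₀ - v₀ := by
    have hx3 : x 3 = z₀ := by rw [← hz₀, ← hr, hz]
    rw [hx3, hr] at e7
    have hx5 : x 5 = v₀ := by linear_combination hv + i₀ * e7 - x 5 * hi
    refine ⟨hx3, hx5, ?_, ?_⟩
    · linear_combination e8 - hx5
    · linear_combination e9 - hx5 + (1 + s) * hr
  rcases mul_eq_zero.1 ((mul_eq_zero.1 hr0).resolve_left (by intro h; linarith)) with hr | hr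
  · left
    obtain ⟨f3, f5, f4, f0⟩ := key (6 - 2 * s + 4 * w - 4 * k) (8 + 2 * s - 4 * k)
      (1 + 1 / 4 * s + 1 / 2 * k) (1 - 1 / 2 * s) (sub_eq_zero.1 hr) (by ring)
      (by clear e10 hr0 hr key; grind (splits := 0)) (by clear e10 hr0 hr key; grind (splits := 0))
    have f0' : x 0 = -1 + 5 / 2 * s - 4 * w + 2 * k := by
      rw [f0]; linear_combination -2 * r1 + 4 * r3 - 4 * r4
    have f1 : x 1 = 2 - 5 / 2 * s + 4 * w - 2 * k := by linear_combination h01 - f0'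
    exact eq_vec f0' f1 h0 f3 (by rw [f4]; ring) f5
  · right
    obtain ⟨f3, f5, f4, f0⟩ := key (-3 - 3 * s + 4 * w) (-1 + s)
      (1 + s) (-9 - 6 * s + 4 * w + 4 * k) (sub_eq_zero.1 hr) (by ring)
      (by clear e10 hr0 hr key; grind (splits := 0)) (by clear e10 hr0 hr key; grind (splits := 0))
    have f0' : x 0 = -2 - 2 * s + 2 * k := by
      rw [f0]; linear_combination -3 * r1 + 4 * r3
    have f1 : x 1 = 3 + 2 * s - 2 * k := by linear_combination h01 - f0'
    exact eq_vec f0' f1 h0 f3 (by rw [f4]; ring) f5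

end Solutions

section Classification

variable {s w k : ℝ} {x : Fin 6 → ℝ} {r B d : ℝ}

lemma EllipseSystem.exists_eq_zero (hx : EllipseSystem s w k x 1 r) (hpos : ∀ i, 0 ≤ x i) :
    x 1 = 0 ∨ x 2 = 0 ∨ x 3 = 0 ∨ x 4 = 0 ∨ x 5 = 0 := by
  have hc : Kippenhahn.cubic x (1 ^ 2) = 0 := by
    rw [Kippenhahn.cubic]
    linear_combination -hx.sum + hx.quadratic - hx.cubic
  have hs : cubicSlope x 1 1 = 0 := by
    rw [cubicSlope]
    linear_combination -5 * hx.sum + 3 * hx.quadratic - hx.cubic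
  obtain ⟨p₂, p₃, p₄, p₅, p₆, q₆, hcd⟩ := exists_christoffel_darboux x 1
  rw [hc, hs] at hcd
  by_contra! hne
  obtain ⟨h1, h2, h3, h4, h5⟩ := hne
  have h0 := hpos 0
  replace h1 := lt_of_le_of_ne (hpos 1) h1.symm
  replace h2 := lt_of_le_of_ne (hpos 2) h2.symm
  replace h3 := lt_of_le_of_ne (hpos 3) h3.symm
  replace h4 := lt_of_le_of_ne (hpos 4) h4.symm
  replace h5 := lt_of_le_of_ne (hpos 5) h5.symm
  have : 0 < p₆ ^ 2 + x 5 * (p₅ ^ 2 + x 4 * (p₄ ^ 2 + x 3 * (p₃ ^ 2 + x 2 * (p₂ ^ 2 +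
        x 1 * (1 ^ 2 + x 0))))) := by positivity
  linarith

lemma EllipseSystem.eq_solution_of_eq_one (h : IsRadicals s w k)
    (hx : EllipseSystem s w k x 1 r) (hpos : ∀ i, 0 ≤ x i) :
    ∃ j : Fin 4, x = solution s w k j ∨ (fun i => x i.rev) = solution s w k j := by
  have hr : 0 ≤ r := by
    have h6 := hx.cubic
    have h0 := hpos 0
    have h1 := hpos 1
    have h2 := hpos 2
    have h3 := hpos 3
    have h4 := hpos 4
    have h5 := hpos 5
    rw [one_pow, one_mul] at h6
    rw [← h6]
    positivity
  have key {x : Fin 6 → ℝ} (hx : EllipseSystem s w k x 1 r) (hpos : ∀ i, 0 ≤ x i)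
      (h0 : x 1 = 0 ∨ x 2 = 0) : ∃ j : Fin 4, x = solution s w k j := by
    rcases h0 with h0 | h0
    · rcases hx.eq_solution_of_second_eq_zero h hpos h0 with h | h
      exacts [⟨0, h⟩, ⟨1, h⟩]
    · rcases hx.eq_solution_of_third_eq_zero h hpos h0 with h | h
      exacts [⟨2, h⟩, ⟨3, h⟩]
  have hpos' (i : Fin 6) : 0 ≤ x i.rev := hpos _
  by_cases h1 : x 1 = 0 ∨ x 2 = 0
  · obtain ⟨j, hj⟩ := key hx hpos h1
    exact ⟨j, Or.inl hj⟩
  by_cases h2 : x 4 = 0 ∨ x 3 = 0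
  · obtain ⟨j, hj⟩ := key hx.rev hpos' h2
    exact ⟨j, Or.inr hj⟩
  exfalso
  have h5 : x 5 = 0 := by
    have := hx.exists_eq_zero hpos
    tauto
  have h0 : x 0 = 0 := by
    have : x 4 = 0 ∨ x 3 = 0 ∨ x 2 = 0 ∨ x 1 = 0 ∨ x 0 = 0 := hx.rev.exists_eq_zero hpos'
    tauto
  have h7 := hx.ends
  rw [h0, h5] at h7
  nlinarith [h.s_gt, h.s_lt, h.k_gt]

lemma EllipseSystem.eq_smul_solution (h : IsRadicals s w k) (hB : 0 < B)
    (hx : EllipseSystem s w k x B d) (hpos : ∀ i, 0 ≤ x i) :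
    ∃ j : Fin 4, x = B • solution s w k j ∨ x = B • fun i => solution s w k j i.rev := by
  have h1 := hx.smul B⁻¹
  rw [inv_mul_cancel₀ hB.ne'] at h1
  obtain ⟨j, hj | hj⟩ := h1.eq_solution_of_eq_one h (fun i => mul_nonneg (by positivity) (hpos i))
  · exact ⟨j, Or.inl (by rw [← hj, smul_inv_smul₀ hB.ne'])⟩
  · refine ⟨j, Or.inr ?_⟩
    rw [← hj]
    ext i
    simp only [Pi.smul_apply, Fin.rev_rev, smul_inv_smul₀ hB.ne']

lemma EllipseSystem.unique (h : IsRadicals s w k) (hx : EllipseSystem s w k x B d) {B' d' : ℝ}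
    (hx' : EllipseSystem s w k x B' d') : B = B' := by
  have h1 : (4 + 4 * s - 2 * k) * (B - B') = 0 := by
    linear_combination (1 + s) * (hx'.sum - hx.sum) - (hx'.ends - hx.ends)
  exact sub_eq_zero.1 ((mul_eq_zero.1 h1).resolve_left (by linarith [h.s_gt, h.k_lt]))

lemma solution_zero_pos (h : IsRadicals s w k) (j : Fin 4) : 0 < solution s w k j 0 := by
  obtain ⟨-, -, -, -, -, -, b1, b2, b3, b4, b5, b6⟩ := h
  fin_cases j <;> simp [solution] <;> linarith

lemma ratio_pos (h : IsRadicals s w k) (j : Fin 4) : 0 < ratio s w k j := by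
  obtain ⟨-, -, -, -, -, -, b1, b2, b3, b4, b5, b6⟩ := h
  fin_cases j <;> simp [ratio] <;> linarith

/-- The solutions normalized by the condition that the first entry of the first four vectors
equals one; the last four vectors are the reversals of the first four. -/
def vectors (s w k : ℝ) : Fin 8 → Fin 6 → ℝ :=
  Fin.addCases (m := 4) (n := 4) (motive := fun _ => Fin 6 → ℝ)
    (fun i => (solution s w k i 0)⁻¹ • solution s w k i)
    (fun i l => (solution s w k i 0)⁻¹ * solution s w k i l.rev)

/-- The minor half-axes of the shifted ellipses. -/
def axes (s w k : ℝ) : Fin 8 → ℝ :=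
  Fin.addCases (m := 4) (n := 4) (motive := fun _ => ℝ)
    (fun i => √((solution s w k i 0)⁻¹ * 1)) (fun i => √((solution s w k i 0)⁻¹ * 1))

/-- The minor half-axes of the centred ellipses. -/
def axes₀ (s w k : ℝ) : Fin 8 → ℝ :=
  Fin.addCases (m := 4) (n := 4) (motive := fun _ => ℝ)
    (fun i => √((solution s w k i 0)⁻¹ * ratio s w k i))
    (fun i => √((solution s w k i 0)⁻¹ * ratio s w k i))

lemma vectors_spec (h : IsRadicals s w k) (j : Fin 8) :
    0 < axes s w k j ∧ 0 < axes₀ s w k j ∧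
      EllipseSystem s w k (vectors s w k j) (axes s w k j ^ 2) (axes₀ s w k j ^ 2) := by
  have hpos (i : Fin 4) : 0 < (solution s w k i 0)⁻¹ * 1 := by
    have := solution_zero_pos h i
    positivity
  have hpos₀ (i : Fin 4) : 0 < (solution s w k i 0)⁻¹ * ratio s w k i :=
    mul_pos (inv_pos.2 (solution_zero_pos h i)) (ratio_pos h i)
  have hsys (i : Fin 4) := (ellipseSystem_solution h i).smul (solution s w k i 0)⁻¹
  refine Fin.addCases (m := 4) (n := 4) (fun i => ?_) (fun i => ?_) j
  · simp only [vectors, axes, axes₀, Fin.addCases_left]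
    refine ⟨Real.sqrt_pos.2 (hpos i), Real.sqrt_pos.2 (hpos₀ i), ?_⟩
    rw [Real.sq_sqrt (hpos i).le, Real.sq_sqrt (hpos₀ i).le]
    exact hsys i
  · simp only [vectors, axes, axes₀, Fin.addCases_right]
    refine ⟨Real.sqrt_pos.2 (hpos i), Real.sqrt_pos.2 (hpos₀ i), ?_⟩
    rw [Real.sq_sqrt (hpos i).le, Real.sq_sqrt (hpos₀ i).le]
    exact (hsys i).rev

lemma EllipseSystem.exists_eq_smul_vectors (h : IsRadicals s w k) (hB : 0 < B)
    (hx : EllipseSystem s w k x B d) (hpos : ∀ i, 0 ≤ x i) :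
    ∃ t : ℝ, 0 < t ∧ ∃ j : Fin 8, x = t • vectors s w k j := by
  obtain ⟨i, hi⟩ := hx.eq_smul_solution h hB hpos
  have h0 := solution_zero_pos h i
  refine ⟨B * solution s w k i 0, mul_pos hB h0, ?_⟩
  rcases hi with hi | hi
  · refine ⟨Fin.castAdd 4 i, ?_⟩
    rw [vectors, Fin.addCases_left, hi, mul_smul, smul_inv_smul₀ h0.ne']
  · refine ⟨Fin.natAdd 4 i, ?_⟩
    rw [vectors, Fin.addCases_right, hi]
    ext l
    simp only [Pi.smul_apply, smul_eq_mul]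
    field_simp

end Classification

section Curve

variable {s w k : ℝ} {A : Matrix (Fin 7) (Fin 7) ℂ}

lemma xi_nonneg (A : Matrix (Fin 7) (Fin 7) ℂ) (i : Fin 6) : 0 ≤ xi A i := by
  rw [xi]; positivity

lemma exists_ellipseSystem_of_ellipse_subset (h : IsRadicals s w k) (hA : IsReciprocal A) {b : ℝ}
    (hb : 0 < b) (hsub : ellipse (w : ℂ) ((-s : ℝ) : ℂ) b ⊆ curve A) :
    ∃ d, EllipseSystem s w k (xi A) (b ^ 2) d := by
  have hkw : (k - w) ^ 2 = 2 - s := by linear_combination h.kk + h.ww - 2 * h.wk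
  obtain ⟨d, hd⟩ := exists_factorization_of_ellipse_subset (f := w) (g := -s) (h := k - w) hA
    (by linear_combination h.ww + h.ss + hkw)
    (by linear_combination (1 + w ^ 2 - s) * h.ss + (w ^ 2 + s ^ 2) * hkw + (4 - s) * h.ww)
    (by linear_combination w ^ 2 * s ^ 2 * hkw + (2 - s) * s ^ 2 * h.ww + (2 - s ^ 2) * h.ss)
    hb (by nlinarith [h.w_gt, h.s_gt]) (by linarith [h.w_gt, h.s_lt]) hsub
  exact ⟨d, (factorization_iff h).1 hd⟩

lemma curve_eq_of_ellipseSystem (h : IsRadicals s w k) (hA : IsReciprocal A) {b b₀ : ℝ}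
    (hb : 0 < b) (hb₀ : 0 < b₀) (hx : EllipseSystem s w k (xi A) (b ^ 2) (b₀ ^ 2)) :
    curve A = ellipse (w : ℂ) ((-s : ℝ) : ℂ) b ∪ -ellipse (w : ℂ) ((-s : ℝ) : ℂ) b ∪
      ellipse ((k - w : ℝ) : ℂ) ((-(k - w) : ℝ) : ℂ) b₀ ∪ {0} :=
  curve_eq_of_factorization hA hb hb₀ ((factorization_iff h).2 hx)

lemma curve_eq_of_xi_eq (h : IsRadicals s w k) (hA : IsReciprocal A) {t : ℝ} {j : Fin 8}
    (ht : 0 < t) (hx : xi A = t • vectors s w k j) :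
    curve A = ellipse (w : ℂ) ((-s : ℝ) : ℂ) (axes s w k j * √t) ∪
      -ellipse (w : ℂ) ((-s : ℝ) : ℂ) (axes s w k j * √t) ∪
      ellipse ((k - w : ℝ) : ℂ) ((-(k - w) : ℝ) : ℂ) (axes₀ s w k j * √t) ∪ {0} ∧
    ∀ b : ℝ, 0 < b → ellipse (w : ℂ) ((-s : ℝ) : ℂ) b ⊆ curve A → b = axes s w k j * √t := by
  obtain ⟨h1, h2, h3⟩ := vectors_spec h j
  have ht' := Real.sqrt_pos.2 ht
  have h4 := h3.smul t
  have e (c : ℝ) : t * c ^ 2 = (c * √t) ^ 2 := by rw [mul_pow, Real.sq_sqrt ht.le, mul_comm]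
  rw [e, e, ← hx] at h4
  refine ⟨curve_eq_of_ellipseSystem h hA (by positivity) (by positivity) h4, fun b hb hsub => ?_⟩
  obtain ⟨d, hd⟩ := exists_ellipseSystem_of_ellipse_subset h hA hb hsub
  exact (sq_eq_sq₀ hb.le (by positivity)).1 (hd.unique h h4)

lemma containsEllipse_iff (h : IsRadicals s w k) (hA : IsReciprocal A) :
    ContainsEllipse A (w : ℂ) ((-s : ℝ) : ℂ) ↔
      ∃ t : ℝ, 0 < t ∧ ∃ j : Fin 8, xi A = t • vectors s w k j := by
  constructor
  · rintro ⟨b, hb, hsub⟩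
    obtain ⟨d, hd⟩ := exists_ellipseSystem_of_ellipse_subset h hA hb hsub
    exact hd.exists_eq_smul_vectors h (by positivity) (xi_nonneg A)
  · rintro ⟨t, ht, j, hx⟩
    refine ⟨axes s w k j * √t, mul_pos (vectors_spec h j).1 (Real.sqrt_pos.2 ht), ?_⟩
    rw [(curve_eq_of_xi_eq h hA ht hx).1]
    intro z hz
    exact Or.inl (Or.inl (Or.inl hz))

end Curve

lemma approx_inv_mul {y a v : ℝ} {n : ℕ} (hy : 0 < y) (h1 : (v - 1 / 2 / 10 ^ n) * y ≤ a)
    (h2 : a ≤ (v + 1 / 2 / 10 ^ n) * y) : Approx (y⁻¹ * a) v n := by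
  rw [Approx, abs_le, inv_mul_eq_div]
  rw [← le_div_iff₀ hy] at h1
  rw [← div_le_iff₀ hy] at h2
  constructor <;> linarith

lemma approx_sqrt_inv_mul {y a v : ℝ} {n : ℕ} (hy : 0 < y) (hv : 0 ≤ v + 1 / 2 / 10 ^ n)
    (h1 : (v - 1 / 2 / 10 ^ n) ^ 2 * y ≤ a) (h2 : a ≤ (v + 1 / 2 / 10 ^ n) ^ 2 * y) :
    Approx √(y⁻¹ * a) v n := by
  rw [Approx, abs_le, inv_mul_eq_div]
  rw [← le_div_iff₀ hy] at h1
  rw [← div_le_iff₀ hy] at h2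
  have h3 := Real.le_sqrt_of_sq_le h1
  have h4 := Real.sqrt_le_iff.2 ⟨hv, h2⟩
  constructor <;> linarith

lemma sqrt_eq_of_mul_self {x y : ℝ} (hy : 0 ≤ y) (h : y * y = x) : √x = y := by
  rw [← h, Real.sqrt_mul_self hy]

lemma vectors_zero_eq {s w k : ℝ} (h : IsRadicals s w k) (hs : √2 = s) (hw : √(2 + √2) = w) :
    vectors s w k 0 = vec₁ ∧ vectors s w k 1 = vec₂ := by
  obtain ⟨r1, r2, r3, r4, r5, r6, b1, b2, b3, b4, b5, b6⟩ := h
  have h1 : √(10 - 7 * s) = 3 * w - 2 * k := by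
    refine sqrt_eq_of_mul_self (by linarith) ?_
    linear_combination 9 * r2 - 12 * r5 + 4 * r6
  have h2 : √(2 * (s + 2)) = k := by
    refine sqrt_eq_of_mul_self (by linarith) ?_
    linear_combination r6
  have h3 : √(4 - 2 * s) = 2 * w - k := by
    refine sqrt_eq_of_mul_self (by linarith) ?_
    linear_combination 4 * r2 - 4 * r5 + r6
  have h4 : √(20 - 14 * s) = 3 * k - 4 * w := by
    refine sqrt_eq_of_mul_self (by linarith) ?_
    linear_combination 16 * r2 - 24 * r5 + 9 * r6
  have h5 : √(s + 2) = w := by rw [← hw, ← hs, add_comm]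
  have h6 : √(2 - s) = k - w := by
    refine sqrt_eq_of_mul_self (by linarith) ?_
    linear_combination r2 - 2 * r5 + r6
  have h7 : √(7 * s + 10) = k + w := by
    refine sqrt_eq_of_mul_self (by linarith) ?_
    linear_combination r2 + 2 * r5 + r6
  have hs0 : s ≠ 0 := by linarith
  have h8 : 3 / s = 3 / 2 * s := by
    rw [div_eq_iff hs0]; linear_combination -3 / 2 * r1
  have h9 : 1 / s = 1 / 2 * s := by
    rw [div_eq_iff hs0]; linear_combination -1 / 2 * r1
  constructor
  · have : vectors s w k 0 = ((1 : ℝ)⁻¹ • solution s w k 0) := rfl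
    rw [this, inv_one, one_smul, vec₁, hs, h1, h2, h3, h4]
    refine eq_vec rfl rfl ?_ ?_ ?_ ?_ <;> simp [solution] <;> ring
  · have : vectors s w k 1 = ((1 : ℝ)⁻¹ • solution s w k 1) := rfl
    rw [this, inv_one, one_smul, vec₂, hs, h2, h5, h6, h7, h8, h9]
    refine eq_vec rfl rfl ?_ ?_ ?_ ?_ <;> simp [solution] <;> ring

end Kippenhahn

end

open Kippenhahn in
theorem mainTheorem7 :
    ∃ (v : Fin 8 → Fin 6 → ℝ) (c c₀ : Fin 8 → ℝ),
      -- the first four vectors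
      v 0 = Kippenhahn.vec₁ ∧ v 1 = Kippenhahn.vec₂ ∧
      (Kippenhahn.Approx (v 0 2) 0.368606 6 ∧ Kippenhahn.Approx (v 0 3) 0.375923 6 ∧
        Kippenhahn.Approx (v 0 4) 0.180645 6 ∧ Kippenhahn.Approx (v 0 5) 0.553537 6) ∧
      (Kippenhahn.Approx (v 1 2) 0.425802 6 ∧ Kippenhahn.Approx (v 1 3) 0.237841 6 ∧
        Kippenhahn.Approx (v 1 4) 0.375923 6 ∧ Kippenhahn.Approx (v 1 5) 0.358259 6) ∧
      (v 2 0 = 1 ∧ Kippenhahn.Approx (v 2 1) 1.69724 5 ∧ v 2 2 = 0 ∧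
        Kippenhahn.Approx (v 2 3) 1.01396 5 ∧ Kippenhahn.Approx (v 2 4) 1.19026 5 ∧
        Kippenhahn.Approx (v 2 5) 0.790003 6) ∧
      (v 3 0 = 1 ∧ Kippenhahn.Approx (v 3 1) 1.51367 5 ∧ v 3 2 = 0 ∧
        Kippenhahn.Approx (v 3 3) 1.04120 5 ∧ Kippenhahn.Approx (v 3 4) 0.944947 6 ∧
        Kippenhahn.Approx (v 3 5) 0.900544 6) ∧
      -- the corresponding minor half-axes, for the scaling factor one
      (c 0 = 1 ∧ c₀ 0 = √(15 - 9 * √2 - 4 * √(20 - 14 * √2))) ∧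
      (c 1 = 1 ∧ c₀ 1 = √(2 * (√(2 * (√2 + 2)) - √2 - 1))) ∧
      (Kippenhahn.Approx (c 2) 1.64233 5 ∧ Kippenhahn.Approx (c₀ 2) 0.544959 6) ∧
      (Kippenhahn.Approx (c 3) 1.58546 5 ∧ Kippenhahn.Approx (c₀ 3) 0.610752 6) ∧
      -- the last four vectors are the reversals of the first four
      (∀ (i : Fin 4) (k : Fin 6), v (Fin.natAdd 4 i) k = v (Fin.castAdd 4 i) k.rev) ∧
      (∀ i : Fin 4, c (Fin.natAdd 4 i) = c (Fin.castAdd 4 i) ∧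
        c₀ (Fin.natAdd 4 i) = c₀ (Fin.castAdd 4 i)) ∧
      ∀ A : Matrix (Fin 7) (Fin 7) ℂ, Kippenhahn.IsReciprocal A →
        (Kippenhahn.ContainsEllipse A (√(2 + √2) : ℝ) (-√2 : ℝ) ↔
          ∃ t : ℝ, 0 < t ∧ ∃ j : Fin 8, Kippenhahn.xi A = t • v j) ∧
        (Kippenhahn.ContainsEllipse A (√(2 + √2) : ℝ) (-√2 : ℝ) ↔
          Kippenhahn.ContainsEllipse A (√2 : ℝ) (-√(2 + √2) : ℝ)) ∧
        ∀ (t : ℝ) (j : Fin 8), 0 < t → Kippenhahn.xi A = t • v j →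
          Kippenhahn.curve A =
            Kippenhahn.ellipse (√(2 + √2) : ℝ) (-√2 : ℝ) (c j * √t) ∪
            -Kippenhahn.ellipse (√(2 + √2) : ℝ) (-√2 : ℝ) (c j * √t) ∪
            Kippenhahn.ellipse (√(2 - √2) : ℝ) (-√(2 - √2) : ℝ) (c₀ j * √t) ∪ {0} ∧
          ∀ b : ℝ, 0 < b →
            Kippenhahn.ellipse (√(2 + √2) : ℝ) (-√2 : ℝ) b ⊆ Kippenhahn.curve A →
            b = c j * √t := by
  have h := isRadicals
  set s := √2 with hs
  set w := √(2 + s) with hw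
  set k := w * s with hk
  clear_value k w s
  obtain ⟨hv0, hv1⟩ := vectors_zero_eq h hs.symm (by rw [← hs, ← hw])
  have hfoci : √(2 - s) = k - w := by
    refine sqrt_eq_of_mul_self (by linarith [h.w_lt, h.k_gt]) ?_
    linear_combination h.kk + h.ww - 2 * h.wk
  have h20 : √(20 - 14 * s) = 3 * k - 4 * w := by
    refine sqrt_eq_of_mul_self (by linarith [h.w_lt, h.k_gt]) ?_
    linear_combination 16 * h.ww - 24 * h.wk + 9 * h.kk
  have h22 : √(2 * (s + 2)) = k := by
    refine sqrt_eq_of_mul_self (by linarith [h.k_gt]) ?_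
    linear_combination h.kk
  have hp := solution_zero_pos h
  have hv (i : Fin 4) (l : Fin 6) :
      vectors s w k (Fin.castAdd 4 i) l = (solution s w k i 0)⁻¹ * solution s w k i l := by
    rw [vectors, Fin.addCases_left]; rfl
  have hc (i : Fin 4) : axes s w k (Fin.castAdd 4 i) = √((solution s w k i 0)⁻¹ * 1) := by
    rw [axes, Fin.addCases_left]
  have hc₀ (i : Fin 4) :
      axes₀ s w k (Fin.castAdd 4 i) = √((solution s w k i 0)⁻¹ * ratio s w k i) := by
    rw [axes₀, Fin.addCases_left]
  have happrox (i : Fin 4) (l : Fin 6) (a : ℝ) (n : ℕ) (h1 : (a - 1 / 2 / 10 ^ n) *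
      solution s w k i 0 ≤ solution s w k i l) (h2 : solution s w k i l ≤
      (a + 1 / 2 / 10 ^ n) * solution s w k i 0) :
      Approx (vectors s w k (Fin.castAdd 4 i) l) a n := by
    rw [hv]; exact approx_inv_mul (hp i) h1 h2
  obtain ⟨-, -, -, -, -, -, b1, b2, b3, b4, b5, b6⟩ := id h
  refine ⟨vectors s w k, axes s w k, axes₀ s w k, hv0, hv1, ?_, ?_, ?_, ?_, ?_, ?_, ?_, ?_, ?_, ?_,
    fun A hA => ⟨containsEllipse_iff h hA, ?_, fun t j ht hx => ?_⟩⟩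
  · refine ⟨happrox 0 2 _ _ ?_ ?_, happrox 0 3 _ _ ?_ ?_, happrox 0 4 _ _ ?_ ?_,
      happrox 0 5 _ _ ?_ ?_⟩ <;>
      simp only [solution, Matrix.cons_val] <;> norm_num <;> linarith
  · refine ⟨happrox 1 2 _ _ ?_ ?_, happrox 1 3 _ _ ?_ ?_, happrox 1 4 _ _ ?_ ?_,
      happrox 1 5 _ _ ?_ ?_⟩ <;>
      simp only [solution, Matrix.cons_val] <;> norm_num <;> linarith
  · refine ⟨(hv 2 0).trans (inv_mul_cancel₀ (hp 2).ne'), happrox 2 1 _ _ ?_ ?_,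
      (hv 2 2).trans (mul_zero _), happrox 2 3 _ _ ?_ ?_, happrox 2 4 _ _ ?_ ?_,
      happrox 2 5 _ _ ?_ ?_⟩ <;>
      simp only [solution, Matrix.cons_val] <;> norm_num <;> linarith
  · refine ⟨(hv 3 0).trans (inv_mul_cancel₀ (hp 3).ne'), happrox 3 1 _ _ ?_ ?_,
      (hv 3 2).trans (mul_zero _), happrox 3 3 _ _ ?_ ?_, happrox 3 4 _ _ ?_ ?_,
      happrox 3 5 _ _ ?_ ?_⟩ <;>
      simp only [solution, Matrix.cons_val] <;> norm_num <;> linarith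
  · refine ⟨(hc 0).trans (by simp [solution]), (hc₀ 0).trans ?_⟩
    rw [h20]
    simp only [solution, ratio, Matrix.cons_val, inv_one, one_mul]
    congr 1
    ring
  · refine ⟨(hc 1).trans (by simp [solution]), (hc₀ 1).trans ?_⟩
    rw [h22]
    simp only [solution, ratio, Matrix.cons_val, inv_one, one_mul]
    congr 1
    ring
  · constructor
    · refine (hc 2).symm ▸ approx_sqrt_inv_mul (hp 2) (by norm_num) ?_ ?_ <;>
      simp only [solution, Matrix.cons_val] <;> norm_num <;> linarith
    · refine (hc₀ 2).symm ▸ approx_sqrt_inv_mul (hp 2) (by norm_num) ?_ ?_ <;>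
        simp only [solution, ratio, Matrix.cons_val] <;> norm_num <;> linarith
  · constructor
    · refine (hc 3).symm ▸ approx_sqrt_inv_mul (hp 3) (by norm_num) ?_ ?_ <;>
      simp only [solution, Matrix.cons_val] <;> norm_num <;> linarith
    · refine (hc₀ 3).symm ▸ approx_sqrt_inv_mul (hp 3) (by norm_num) ?_ ?_ <;>
        simp only [solution, ratio, Matrix.cons_val] <;> norm_num <;> linarith
  · intro i l
    rw [hv, vectors, Fin.addCases_right]
  · intro i
    rw [hc, hc₀, axes, axes₀, Fin.addCases_right, Fin.addCases_right]
    exact ⟨rfl, rfl⟩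
  · rw [containsEllipse_neg_iff hA]
    push_cast
    rw [neg_neg]
  · rw [hfoci]
    exact curve_eq_of_xi_eq h hA ht hx
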